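/- **Proposition 4.2.** For integers $m\ge 1$ and $n\ge 1$, let $T_m$ be the Hecke correspondence on $\mathbb{C}^n$, i.e. the correspondence given by the set of pairs $(x,y)\in\mathbb{C}^n\times\mathbb{C}^n$ such that, for every $i$, $x_i$ and $y_i$ are the $j$-invariants of complex elliptic curves $E_i$, $E_i'$ for which there is an isogeny $E_i\to E_i'$ with kernel isomorphic to $\mathbb{Z}/m\mathbb{Z}$; for $Z\subset\mathbb{C}^n$, let $T_mZ$ be the set of all $y\in\mathbb{C}^n$ such that $(x,y)\in T_m$ for some $x\in Z$. Let $n\ge 3$ be an integer and let $Z\subset\mathbb{C}^n$ be a closed irreducible algebraic hypersurface. Suppose that for every $i\in\{1,\dots,n\}$ the projection $p_i\colon Z\to\mathbb{C}^{n-1}$ that forgets the $i$-th coordinate is dominant, and let $\deg(p_i)$ be its degree, i.e. the degree of the function field of $Z$ over the function field of $\mathbb{C}^{n-1}$. Let $m>1$ be an integer all of whose prime divisors $l$ satisfy $l>3$ and $l>\deg(p_i)$ for all $i$. Then $T_mZ$ is irreducible (for the Zariski topology). -/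

import Mathlib

noncomputable section

namespace HeckeIrr

/-! ### The Zariski topology on complex affine space -/

/-- The Zariski topology on `ℂ^σ` (`σ` an index set): the closed sets are the common zero loci of
the ideals of the polynomial ring in the variables indexed by `σ`. -/
@[reducible] def zariskiTopology (σ : Type) : TopologicalSpace (σ → ℂ) :=
  TopologicalSpace.ofClosed
    {Z | ∃ I : Ideal (MvPolynomial σ ℂ), Z = MvPolynomial.zeroLocus ℂ I}
    ⟨⊤, by ext; simp⟩
    (by
      intro A hA
      refine ⟨sSup {I | MvPolynomial.zeroLocus ℂ I ∈ A}, ?_⟩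
      ext x
      have key : (∀ p ∈ sSup {I : Ideal (MvPolynomial σ ℂ) | MvPolynomial.zeroLocus ℂ I ∈ A},
          MvPolynomial.aeval x p = 0) ↔
          sSup {I : Ideal (MvPolynomial σ ℂ) | MvPolynomial.zeroLocus ℂ I ∈ A} ≤
            RingHom.ker (MvPolynomial.aeval (R := ℂ) x) := Iff.rfl
      rw [MvPolynomial.mem_zeroLocus_iff, key, sSup_le_iff, Set.mem_sInter]
      constructor
      · intro h I hI p hp
        exact h _ hI p hp
      · intro h Z hZ
        obtain ⟨I, rfl⟩ := hA hZ
        intro p hp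
        exact h I hZ hp)
    (by
      rintro _ ⟨I, rfl⟩ _ ⟨J, rfl⟩
      refine ⟨I * J, ?_⟩
      ext x
      constructor
      · rintro (h | h)
        · exact MvPolynomial.zeroLocus_anti_mono (Ideal.mul_le_left (I := I) (J := J)) h
        · exact MvPolynomial.zeroLocus_anti_mono (Ideal.mul_le_right (I := I) (J := J)) h
      · intro h
        by_contra hx
        simp only [Set.mem_union, MvPolynomial.mem_zeroLocus_iff, not_or, not_forall] at hx
        obtain ⟨⟨p, hp, hpx⟩, q, hq, hqx⟩ := hx
        have := h (p * q) (Ideal.mul_mem_mul hp hq)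
        rw [map_mul, mul_eq_zero] at this
        exact this.elim hpx hqx)

theorem isClosed_zariski_iff {σ : Type} (Z : Set (σ → ℂ)) :
    @IsClosed _ (zariskiTopology σ) Z ↔
      ∃ I : Ideal (MvPolynomial σ ℂ), Z = MvPolynomial.zeroLocus ℂ I := by
  rw [← @isOpen_compl_iff _ _ (zariskiTopology σ)]
  change Zᶜᶜ ∈ _ ↔ _
  rw [compl_compl]
  rfl

/-- Irreducibility of a subset of `ℂ^σ` in the Zariski topology (this includes being nonempty). -/
def IsZariskiIrreducible {σ : Type} (Z : Set (σ → ℂ)) : Prop :=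
  @IsIrreducible _ (zariskiTopology σ) Z

/-- Density of a subset of `ℂ^σ` in the Zariski topology. -/
def IsZariskiDense {σ : Type} (Z : Set (σ → ℂ)) : Prop :=
  @Dense _ (zariskiTopology σ) Z

/-- A hypersurface in `ℂ^σ`: the zero locus of a single nonconstant polynomial. -/
def IsHypersurface {σ : Type} (Z : Set (σ → ℂ)) : Prop :=
  ∃ f : MvPolynomial σ ℂ, f ≠ 0 ∧ ¬ IsUnit f ∧ Z = MvPolynomial.zeroLocus ℂ (Ideal.span {f})

/-! ### Projections to the coordinate hyperplanes, function fields, degrees -/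

/-- The projection `ℂ^σ → ℂ^{σ \ {i}}` that forgets the `i`-th coordinate. -/
def proj {σ : Type} (i : σ) (x : σ → ℂ) : {j : σ // j ≠ i} → ℂ := fun j => x j

/-- The ideal of an irreducible set is prime. -/
theorem IsZariskiIrreducible.isPrime {σ : Type} {Z : Set (σ → ℂ)} (hZ : IsZariskiIrreducible Z) :
    (MvPolynomial.vanishingIdeal ℂ Z).IsPrime := by
  refine ⟨?_, ?_⟩
  · intro h
    obtain ⟨x, hx⟩ := hZ.1
    have h1 : (1 : MvPolynomial σ ℂ) ∈ MvPolynomial.vanishingIdeal ℂ Z := h ▸ Submodule.mem_top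
    simpa using h1 x hx
  · intro p q hpq
    have h := (@isPreirreducible_iff_isClosed_union_isClosed _ (zariskiTopology σ) Z).1 hZ.2
      (MvPolynomial.zeroLocus ℂ (Ideal.span {p})) (MvPolynomial.zeroLocus ℂ (Ideal.span {q}))
      ((isClosed_zariski_iff _).2 ⟨_, rfl⟩) ((isClosed_zariski_iff _).2 ⟨_, rfl⟩) (by
        intro x hx
        have h0 := hpq x hx
        rw [map_mul, mul_eq_zero] at h0
        simpa [MvPolynomial.zeroLocus_span] using h0)
    simpa [MvPolynomial.zeroLocus_span, Set.subset_def] using h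

/-- The coordinate ring `ℂ[Z] = ℂ[x_j : j ∈ σ] / I(Z)`. -/
abbrev CoordRing {σ : Type} (Z : Set (σ → ℂ)) : Type :=
  MvPolynomial σ ℂ ⧸ MvPolynomial.vanishingIdeal ℂ Z

/-- The degree of the projection `Z → ℂ^{σ \ {i}}` of an irreducible `Z`: the degree of the
function field `ℂ(Z)` over its subfield `ℂ(x_j : j ≠ i)` generated by the coordinate functions
other than the `i`-th one. When the projection is dominant, these coordinate functions are
algebraically independent on `Z`, and this subfield is the function field of `ℂ^{σ \ {i}}`,
embedded by pull-back of functions. -/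
def projDegree {σ : Type} (Z : Set (σ → ℂ)) (hZ : IsZariskiIrreducible Z) (i : σ) : ℕ :=
  haveI : (MvPolynomial.vanishingIdeal ℂ Z).IsPrime := hZ.isPrime
  Module.finrank
    (IntermediateField.adjoin ℂ {g : FractionRing (CoordRing Z) | ∃ j : σ, j ≠ i ∧
      g = algebraMap (CoordRing Z) (FractionRing (CoordRing Z))
        (Ideal.Quotient.mk _ (MvPolynomial.X j))})
    (FractionRing (CoordRing Z))

/-! ### Elliptic curves over `ℂ` and the Hecke correspondence -/

/-- The `j`-invariant `1728 g₂³ / (g₂³ - 27 g₃²)` of the complex elliptic curve `ℂ / L`, which has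
the Weierstrass equation `y² = 4 x³ - g₂ x - g₃`. -/
def jInv (L : PeriodPair) : ℂ := 1728 * L.g₂ ^ 3 / (L.g₂ ^ 3 - 27 * L.g₃ ^ 2)

/-- There is an isogeny `ℂ / L → ℂ / L'` with kernel isomorphic to `ℤ / mℤ`. The isogenies
`ℂ / L → ℂ / L'` are the maps induced by multiplication by a complex number `α ≠ 0` with
`α L ⊆ L'`. -/
def CyclicIsogeny (m : ℕ) (L L' : PeriodPair) : Prop :=
  ∃ α : ℂ, α ≠ 0 ∧ ∃ h : L.lattice ≤ L'.lattice.comap (LinearMap.mulLeft ℤ α),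
    Nonempty (LinearMap.ker (Submodule.mapQ L.lattice L'.lattice (LinearMap.mulLeft ℤ α) h)
      ≃+ ZMod m)

/-- The Hecke correspondence `T_m` on `ℂ^σ`, as a subset of `ℂ^σ × ℂ^σ`: the pairs `(x, y)` such
that for every `i`, `x_i` and `y_i` are the `j`-invariants of elliptic curves `E_i`, `E'_i`
over `ℂ` for which there is an isogeny `E_i → E'_i` with kernel isomorphic to `ℤ / mℤ`. -/
def heckeCorr (m : ℕ) (σ : Type) : Set ((σ → ℂ) × (σ → ℂ)) :=
  {p | ∀ i, ∃ L L' : PeriodPair, jInv L = p.1 i ∧ jInv L' = p.2 i ∧ CyclicIsogeny m L L'}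

/-- The image `T_m Z` of a subset `Z` of `ℂ^σ` under the Hecke correspondence `T_m`. -/
def heckeImage {σ : Type} (m : ℕ) (Z : Set (σ → ℂ)) : Set (σ → ℂ) :=
  {y | ∃ x ∈ Z, (x, y) ∈ heckeCorr m σ}

end HeckeIrr

end

/-!
Uniformize `ℂ` by the modular curve `X = Γ(m) \ ℍ`: the function `j` maps `X` onto `ℂ`, and the
pairs of `j`-invariants joined by an isogeny with kernel `ℤ / m` are the pairs `(j(τ), j(mτ))`, so
`T_m Z` is the image under `j(mτ)`, applied to all coordinates, of the preimage of `Z` in `Xⁿ`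
(`heckeImage_eq`). The group `G = SL₂(ℤ) / Γ(m)` acts on the coordinate ring of `X`, with invariants
`ℂ[j]` (`isInvariantDomain_modularAlg`), so `Gⁿ` acts on the coordinate ring `B` of `Xⁿ`, with
invariants the polynomial ring `A` in `n` variables. The set `T_m Z` is irreducible as soon as
some prime `Q` of `B` over the ideal of `Z` is stable under `Gⁿ`, that is, its decomposition
group `D` is everything (`IsInvariantDomain.isZariskiIrreducible`).

To prove `D = Gⁿ`, fix `i`. Since `p_i` is dominant, the ring of functions of the coordinates other
than the `i`-th one embeds in `B / Q`, and Galois theory over the function field of `Z` shows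
that the index of the image of `D` in the product of the other copies of `G` is at most
`deg p_i` (`index_le_finrank`, `IsInvariantDomain.index_eraseSubgroup_le`). But `G` is generated by
elements of order dividing `m`, the images of `T` and of a conjugate of it
(`closure_torsion_eq_top`), and such elements lie in every subgroup whose index is smaller than all
prime divisors of `m` (`mem_of_pow_eq_one_of_index_lt`). So `D` surjects to each product of `n - 1`
copies of `G`. As `m` is prime to `12`, the group `G` is perfect (`commutator_eq_top`), and as
`n ≥ 3`, every commutator in a factor of `Gⁿ` is a commutator of elements of `D`
(`pi_eq_top_of_forall_erase`).

The analytic input is that an `SL₂(ℤ)`-invariant holomorphic function with at most a pole at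
infinity is a polynomial in `j` (`exists_eval_kleinJ`), that `j` is surjective, and that `j(mτ)` is
meromorphic at all cusps (`isBoundedAtImInfty_kleinJ_scale_smul`).
-/

noncomputable section

namespace HeckeIrr

/-! ### Subgroups of powers of a group, and quotients of `SL₂(ℤ)` -/

section

open scoped commutatorElement

open Matrix.SpecialLinearGroup ModularGroup in
open scoped MatrixGroups in
theorem S_inv_eq : (S : SL(2, ℤ))⁻¹ = T * (S * T * S⁻¹) * T := by decide

open ModularGroup in
open scoped MatrixGroups in
theorem S_pow_four : (S : SL(2, ℤ)) ^ 4 = 1 := by decide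

/-- A subgroup whose index is smaller than every prime divisor of `m` contains all elements of
order dividing `m`: the orbits of such an element on the cosets have length dividing `m`. -/
theorem mem_of_pow_eq_one_of_index_lt {G : Type*} [Group G] (H : Subgroup G) (hH : H.index ≠ 0)
    {m : ℕ} (hl : ∀ l : ℕ, l.Prime → l ∣ m → H.index < l) {u : G} (hu : u ^ m = 1) : u ∈ H := by
  have h1 : H.relIndex (Subgroup.zpowers u) ∣ m :=
    (Subgroup.relIndex_dvd_card _ _).trans (by
      rw [Nat.card_zpowers]
      exact orderOf_dvd_of_pow_eq_one hu)
  have h2 : H.relIndex (Subgroup.zpowers u) ≤ H.index := by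
    rw [← Subgroup.relIndex_top_right]
    exact Subgroup.relIndex_le_of_le_right le_top (by rwa [Subgroup.relIndex_top_right])
  have h3 : H.relIndex (Subgroup.zpowers u) = 1 := by
    by_contra hne
    have hp := Nat.minFac_prime hne
    have hlt := hl _ hp ((Nat.minFac_dvd _).trans h1)
    have h0 : H.relIndex (Subgroup.zpowers u) ≠ 0 := by
      have : H.FiniteIndex := ⟨hH⟩
      exact Subgroup.FiniteIndex.index_ne_zero (H := H.subgroupOf (Subgroup.zpowers u))
    have := Nat.minFac_le (Nat.pos_of_ne_zero h0)
    omega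
  exact Subgroup.relIndex_eq_one.1 h3 (Subgroup.mem_zpowers u)

/-- A subgroup of `G ^ ι` of small index is everything, if `G` is generated by elements of
order dividing `m`. -/
theorem pi_eq_top_of_index_lt {ι G : Type*} [Finite ι] [Group G] {m : ℕ}
    (hgen : Subgroup.closure {u : G | u ^ m = 1} = ⊤) (H : Subgroup (ι → G)) (hH : H.index ≠ 0)
    (hl : ∀ l : ℕ, l.Prime → l ∣ m → H.index < l) : H = ⊤ := by
  classical
  refine (Subgroup.eq_top_iff' H).2 fun g => ?_
  refine Subgroup.pi_mem_of_mulSingle_mem g fun i => ?_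
  have : Subgroup.closure {u : G | u ^ m = 1} ≤
      H.comap (MonoidHom.mulSingle (fun _ : ι => G) i) := by
    rw [Subgroup.closure_le]
    intro u hu
    refine mem_of_pow_eq_one_of_index_lt H hH hl ?_
    rw [← map_pow, hu, map_one]
  rw [hgen] at this
  exact this (Subgroup.mem_top (g i))

/-- **Goursat-type lemma.** If `G` is perfect and `ι` has at least three elements, a subgroup of
`G ^ ι` which surjects to `G ^ (ι \ {i})` for every `i` is everything. -/
theorem pi_eq_top_of_forall_erase {ι G : Type*} [Fintype ι] [Group G] (hι : 3 ≤ Fintype.card ι)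
    (hperf : commutator G = ⊤) (D : Subgroup (ι → G))
    (hD : ∀ i, ∀ g : ι → G, ∃ d ∈ D, ∀ k, k ≠ i → d k = g k) : D = ⊤ := by
  classical
  refine (Subgroup.eq_top_iff' D).2 fun g => ?_
  refine Subgroup.pi_mem_of_mulSingle_mem g fun i => ?_
  obtain ⟨i₁, hi₁⟩ : ∃ i₁, i₁ ≠ i :=
    Fintype.exists_ne_of_one_lt_card (by omega) i
  obtain ⟨i₂, hi₂⟩ : ∃ i₂, i₂ ∉ ({i, i₁} : Finset ι) := by
    by_contra! h
    have := Finset.card_le_card (fun x _ => h x : (Finset.univ : Finset ι) ⊆ {i, i₁})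
    have := Finset.card_le_two (a := i) (b := i₁)
    rw [Finset.card_univ] at *
    omega
  simp only [Finset.mem_insert, Finset.mem_singleton, not_or] at hi₂
  have : commutator G ≤ D.comap (MonoidHom.mulSingle (fun _ : ι => G) i) := by
    rw [commutator_def, Subgroup.commutator_le]
    intro a _ b _
    -- lift `a` and `b`, placed at `i`, to elements of `D` trivial except at `i`, `i₁` and `i`, `i₂`
    obtain ⟨d, hd, hd'⟩ := hD i₁ (Pi.mulSingle i a)
    obtain ⟨e, he, he'⟩ := hD i₂ (Pi.mulSingle i b)
    have : MonoidHom.mulSingle (fun _ : ι => G) i ⁅a, b⁆ = ⁅d, e⁆ := by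
      ext k
      simp only [MonoidHom.mulSingle_apply, commutatorElement_def, Pi.mul_apply, Pi.inv_apply]
      by_cases hk : k = i
      · subst hk
        rw [hd' k hi₁.symm, he' k (Ne.symm hi₂.1)]
        simp
      · rw [Pi.mulSingle_eq_of_ne hk]
        by_cases hk1 : k = i₁
        · subst hk1
          rw [he' k (Ne.symm hi₂.2), Pi.mulSingle_eq_of_ne hk]
          simp
        · rw [hd' k hk1, Pi.mulSingle_eq_of_ne hk]
          simp
    change MonoidHom.mulSingle (fun _ : ι => G) i ⁅a, b⁆ ∈ D
    rw [this, commutatorElement_def]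
    exact D.mul_mem (D.mul_mem (D.mul_mem hd he) (D.inv_mem hd)) (D.inv_mem he)
  rw [hperf] at this
  exact this (Subgroup.mem_top (g i))

open ModularGroup in
open scoped MatrixGroups in
/-- A quotient of `SL₂(ℤ)` in which the image of `T` is killed by `m` is generated by elements of
order dividing `m`, namely the images of `T` and its conjugate by `S`. -/
theorem closure_torsion_eq_top {G : Type*} [Group G] (φ : SL(2, ℤ) →* G)
    (hφ : Function.Surjective φ) {m : ℕ} (hm : φ T ^ m = 1) :
    Subgroup.closure {u : G | u ^ m = 1} = ⊤ := by
  set H := Subgroup.closure {u : G | u ^ m = 1}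
  have hT : φ T ∈ H := Subgroup.subset_closure hm
  have hV : φ (S * T * S⁻¹) ∈ H := Subgroup.subset_closure (by
    simp only [map_mul, map_inv, Set.mem_ofPred_eq, conj_pow, hm, mul_one, mul_inv_cancel])
  have hS : φ S ∈ H := by
    rw [← inv_inv (φ S), ← map_inv, S_inv_eq, map_mul, map_mul]
    exact H.inv_mem (H.mul_mem (H.mul_mem hT hV) hT)
  have : Subgroup.closure {S, T} ≤ H.comap φ := by
    rw [Subgroup.closure_le]
    rintro _ (rfl | rfl)
    exacts [hS, hT]
  rw [SpecialLinearGroup.SL2Z_generators] at this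
  refine (Subgroup.eq_top_iff' H).2 fun g => ?_
  obtain ⟨γ, rfl⟩ := hφ g
  exact this (Subgroup.mem_top γ)

open ModularGroup in
open scoped MatrixGroups in
/-- A quotient of `SL₂(ℤ)` in which the image of `T` is killed by an `m` prime to `12` is perfect:
the abelianization of `SL₂(ℤ)` is generated by `T`, with `T ^ 12 = 1`. -/
theorem commutator_eq_top {G : Type*} [Group G] (φ : SL(2, ℤ) →* G)
    (hφ : Function.Surjective φ) {m : ℕ} (hm : φ T ^ m = 1) (hm12 : Nat.Coprime m 12) :
    commutator G = ⊤ := by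
  set ψ : SL(2, ℤ) →* Abelianization G := Abelianization.of.comp φ with hψ
  have hTm : ψ T ^ m = 1 := by
    rw [hψ, MonoidHom.comp_apply, ← map_pow, hm, map_one]
  have hST : (ψ S)⁻¹ = ψ T ^ 3 := by
    have : ψ S⁻¹ = ψ (T * (S * T * S⁻¹) * T) := congrArg ψ S_inv_eq
    rw [map_inv] at this
    rw [this]
    simp only [map_mul, map_inv]
    rw [mul_comm (ψ S) (ψ T), mul_inv_cancel_right, pow_three, mul_assoc]
  have hT12 : ψ T ^ 12 = 1 := by
    have h4 : ψ S ^ 4 = 1 := by rw [← map_pow, S_pow_four, map_one]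
    rw [show 12 = 3 * 4 from rfl, pow_mul, ← hST, inv_pow, h4, inv_one]
  have hT : ψ T = 1 := by
    rw [← orderOf_eq_one_iff, ← Nat.dvd_one, ← hm12]
    exact Nat.dvd_gcd (orderOf_dvd_of_pow_eq_one hTm) (orderOf_dvd_of_pow_eq_one hT12)
  have hS : ψ S = 1 := by
    rw [← inv_eq_one, hST, hT, one_pow]
  have : Subgroup.closure {S, T} ≤ ψ.ker := by
    rw [Subgroup.closure_le]
    rintro _ (rfl | rfl)
    exacts [hS, hT]
  rw [SpecialLinearGroup.SL2Z_generators] at this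
  refine (Subgroup.eq_top_iff' _).2 fun g => ?_
  obtain ⟨γ, rfl⟩ := hφ g
  rw [← Abelianization.ker_of]
  exact this (Subgroup.mem_top γ)

end

/-! ### Decomposition groups and degrees of function fields -/

section

/-- Two embeddings `ι`, `ι'` of a domain `B₀` in fields differ by a homomorphism `φ` of these
fields, if the source is algebraic over the field of fractions of `B₀` and the target is algebraically
closed. That the source is algebraic is expressed through a field `F` of quotients of elements of
`B₀`. -/
theorem exists_ringHom_extension {F Ω Ω' B₀ : Type*} [Field F] [Field Ω] [Field Ω'] [CommRing B₀]
    [IsDomain B₀] [Algebra F Ω] [Algebra.IsAlgebraic F Ω] [IsAlgClosed Ω'] (ι : B₀ →+* Ω)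
    (ι' : B₀ →+* Ω') (hι : Function.Injective ι) (hι' : Function.Injective ι')
    (hF : ∀ x : F, ∃ a b : B₀, algebraMap F Ω x = ι a / ι b) :
    ∃ φ : Ω →+* Ω', ∀ b, φ (ι b) = ι' b := by
  let L₀ := FractionRing B₀
  let l : L₀ →+* Ω := IsFractionRing.lift hι
  let l' : L₀ →+* Ω' := IsFractionRing.lift hι'
  have hl : ∀ b, l (algebraMap B₀ L₀ b) = ι b := fun b => IsFractionRing.lift_algebraMap hι b
  have hl' : ∀ b, l' (algebraMap B₀ L₀ b) = ι' b := fun b => IsFractionRing.lift_algebraMap hι' b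
  have hmem : ∀ x : F, algebraMap F Ω x ∈ l.range := by
    intro x
    obtain ⟨a, b, h⟩ := hF x
    exact ⟨algebraMap B₀ L₀ a / algebraMap B₀ L₀ b, by rw [map_div₀, hl, hl, h]⟩
  let e : L₀ ≃+* l.range := RingEquiv.ofBijective l.rangeRestrict
    ⟨fun x y h => l.injective (congrArg Subtype.val h), l.rangeRestrict_surjective⟩
  let f : F →+* L₀ := (e.symm : l.range →+* L₀).comp ((algebraMap F Ω).codRestrict l.range hmem)
  have hf : ∀ x, l (f x) = algebraMap F Ω x := by
    intro x
    have : e (f x) = (algebraMap F Ω).codRestrict l.range hmem x := by simp [f]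
    exact congrArg Subtype.val this
  let : Algebra L₀ Ω := l.toAlgebra
  let : Algebra L₀ Ω' := l'.toAlgebra
  let : Algebra F L₀ := f.toAlgebra
  have : IsScalarTower F L₀ Ω := IsScalarTower.of_algebraMap_eq fun x => (hf x).symm
  have : Algebra.IsAlgebraic L₀ Ω := Algebra.IsAlgebraic.tower_top (K := F) L₀
  let φ : Ω →ₐ[L₀] Ω' := IsAlgClosed.lift
  refine ⟨φ, fun b => ?_⟩
  rw [← hl, ← hl']
  exact φ.commutes (algebraMap B₀ L₀ b)

section Index

variable {A B 𝒢 : Type*} [CommRing A] [CommRing B] [Algebra A B] [Group 𝒢] [Finite 𝒢]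
  [MulSemiringAction 𝒢 B] [SMulCommClass 𝒢 A B] [Algebra.IsInvariant A B 𝒢]

open scoped Pointwise in
/-- Let the finite group `𝒢` act on `B` with invariants `A`, let `Q` be a prime of `B` over `p`,
and let `B₀` be a `𝒢`-stable subring of `B` which embeds in `B / Q`. If a subgroup `H` contains all
elements which act on `B₀` like an element of the decomposition group of `Q`, then its index is at
most the degree of the function field `K` of `A / p` over the fraction field `F` of the invariants
in `B₀`: an element `g` extends from `B₀` to an algebraic closure of `K`, and the coset `g H`
can be read off from the resulting `F`-embedding of `K`. -/
theorem index_le_finrank (p : Ideal A) (Q : Ideal B) [p.IsPrime] [Q.IsPrime] [Q.LiesOver p]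
    (K L : Type*) [Field K] [Field L] [Algebra K L]
    [Algebra (A ⧸ p) K] [IsFractionRing (A ⧸ p) K] [Algebra (B ⧸ Q) L] [IsFractionRing (B ⧸ Q) L]
    [Algebra (A ⧸ p) L] [IsScalarTower (A ⧸ p) (B ⧸ Q) L] [IsScalarTower (A ⧸ p) K L]
    (F : Type*) [Field F] [Algebra F K] [FiniteDimensional F K]
    (B₀ : Subring B) (hstab : ∀ (g : 𝒢), ∀ b ∈ B₀, g • b ∈ B₀) (hB₀ : ∀ b ∈ B₀, b ∈ Q → b = 0)
    (hF : ∀ x : F, ∃ a b : A, algebraMap A B a ∈ B₀ ∧ algebraMap A B b ∈ B₀ ∧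
      algebraMap F K x =
        algebraMap (A ⧸ p) K (Ideal.Quotient.mk p a) / algebraMap (A ⧸ p) K (Ideal.Quotient.mk p b))
    (H : Subgroup 𝒢)
    (hH : ∀ g : 𝒢, ∀ d ∈ MulAction.stabilizer 𝒢 Q, (∀ b ∈ B₀, d • b = g • b) → g ∈ H) :
    H.index ≤ Module.finrank F K := by
  have : Normal K L := Ideal.IsFractionRing.normal (G := 𝒢) p Q K L
  let Ω := AlgebraicClosure L
  let : Algebra F L := ((algebraMap K L).comp (algebraMap F K)).toAlgebra
  have : IsScalarTower F K L := IsScalarTower.of_algebraMap_eq fun x => rfl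
  have : Algebra.IsAlgebraic K L := Normal.toIsAlgebraic
  have : Algebra.IsAlgebraic F L := Algebra.IsAlgebraic.trans F K L
  have : Algebra.IsAlgebraic F Ω := Algebra.IsAlgebraic.trans F L Ω
  let ι : B →+* Ω := (algebraMap L Ω).comp ((algebraMap (B ⧸ Q) L).comp (Ideal.Quotient.mk Q))
  have hι : ∀ b c, ι b = ι c → b - c ∈ Q := by
    intro b c h
    rw [← Ideal.Quotient.eq]
    exact IsFractionRing.injective (B ⧸ Q) L ((algebraMap L Ω).injective h)
  have hιA : ∀ a : A, ι (algebraMap A B a) =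
      algebraMap K Ω (algebraMap (A ⧸ p) K (Ideal.Quotient.mk p a)) := by
    intro a
    rw [IsScalarTower.algebraMap_apply K L Ω, ← IsScalarTower.algebraMap_apply (A ⧸ p) K L,
      IsScalarTower.algebraMap_apply (A ⧸ p) (B ⧸ Q) L]
    rfl
  have hinj : Function.Injective (ι.comp B₀.subtype) := by
    intro x y h
    have := hB₀ _ (B₀.sub_mem x.2 y.2) (hι _ _ h)
    exact Subtype.ext (sub_eq_zero.1 this)
  have : IsDomain B₀ := hinj.isDomain _
  have hext : ∀ g : 𝒢, ∃ φ : Ω →ₐ[F] Ω, ∀ b ∈ B₀, φ (ι b) = ι (g • b) := by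
    intro g
    let τ : B₀ →+* B := (MulSemiringAction.toRingHom 𝒢 B g).comp B₀.subtype
    have hF' : ∀ x : F, ∃ a b : A, ∃ ha : algebraMap A B a ∈ B₀, ∃ hb : algebraMap A B b ∈ B₀,
        algebraMap F Ω x = ι (algebraMap A B a) / ι (algebraMap A B b) := by
      intro x
      obtain ⟨a, b, ha, hb, h⟩ := hF x
      refine ⟨a, b, ha, hb, ?_⟩
      rw [IsScalarTower.algebraMap_apply F K Ω, h, map_div₀, hιA, hιA]
    obtain ⟨φ, hφ⟩ := exists_ringHom_extension (F := F) (ι.comp B₀.subtype) (ι.comp τ) hinj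
      (by
        intro x y h
        have h' : g • (x : B) - g • (y : B) ∈ Q := hι _ _ h
        have := hB₀ _ (B₀.sub_mem (hstab g _ x.2) (hstab g _ y.2)) h'
        exact Subtype.ext (smul_left_cancel g (sub_eq_zero.1 this)))
      (fun x => by
        obtain ⟨a, b, ha, hb, h⟩ := hF' x
        exact ⟨⟨_, ha⟩, ⟨_, hb⟩, h⟩)
    refine ⟨{ φ with commutes' := fun x => ?_ }, fun b hb => hφ ⟨b, hb⟩⟩
    obtain ⟨a, b, ha, hb, h⟩ := hF' x
    have hfix : ∀ c : A, algebraMap A B c ∈ B₀ →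
        φ (ι (algebraMap A B c)) = ι (algebraMap A B c) := by
      intro c hc
      refine (hφ ⟨_, hc⟩).trans ?_
      change ι (g • algebraMap A B c) = _
      rw [smul_algebraMap]
    change φ _ = _
    rw [h, map_div₀, hfix a ha, hfix b hb]
  choose φ hφ using hext
  have key : ∀ g h : 𝒢, (∀ x : K, φ g (algebraMap K Ω x) = φ h (algebraMap K Ω x)) →
      h⁻¹ * g ∈ H := by
    intro g h hgh
    let eg : Ω ≃ₐ[F] Ω := AlgEquiv.ofBijective (φ g) (Algebra.IsAlgebraic.algHom_bijective _)
    let eh : Ω ≃ₐ[F] Ω := AlgEquiv.ofBijective (φ h) (Algebra.IsAlgebraic.algHom_bijective _)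
    let σ : Ω ≃ₐ[K] Ω := AlgEquiv.ofRingEquiv (f := (eg.trans eh.symm).toRingEquiv) (fun x => by
      change eh.symm (eg (algebraMap K Ω x)) = _
      rw [AlgEquiv.symm_apply_eq]
      exact hgh x)
    obtain ⟨d, hd⟩ := IsFractionRing.stabilizerHom_surjective 𝒢 p Q K L (σ.restrictNormal L)
    refine hH _ d.1 d.2 fun b hb => ?_
    have hgb := hstab g b hb
    have h1 : ι (d.1 • b) = σ (ι b) := by
      have := IsFractionRing.stabilizerHom_apply_apply_mk 𝒢 p Q K L d b
      rw [hd] at this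
      have h2 := σ.restrictNormal_commutes L (algebraMap (B ⧸ Q) L (Ideal.Quotient.mk Q b))
      rw [this] at h2
      exact h2
    have h3 : σ (ι b) = ι ((h⁻¹ * g) • b) := by
      change eh.symm (eg (ι b)) = _
      rw [AlgEquiv.symm_apply_eq]
      change φ g (ι b) = φ h _
      rw [hφ g b hb, mul_smul, hφ h _ (hstab _ _ hgb), smul_inv_smul]
    have h4 := hι _ _ (h1.trans h3)
    exact sub_eq_zero.1 (hB₀ _ (B₀.sub_mem (hstab _ _ hb) (hstab _ _ hb)) h4)
  refine le_trans ?_ (card_algHom_le_finrank F K Ω)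
  refine Nat.card_le_card_of_injective
    (fun q : 𝒢 ⧸ H => (φ q.out).comp (IsScalarTower.toAlgHom F K Ω)) fun q q' h => ?_
  have := key q.out q'.out fun x => DFunLike.congr_fun h x
  rw [← QuotientGroup.out_eq' q, ← QuotientGroup.out_eq' q']
  exact (QuotientGroup.eq.2 this).symm

end Index

end

/-! ### Functions on a power of a set with a group action -/

section

open MvPolynomial

/-- `R` is an integral domain of functions on the `G`-set `X`, stable under `G`, whose invariants
are the polynomials in the surjective function `j`. -/
structure IsInvariantDomain (G : Type*) {X : Type*} [Group G] [MulAction G X]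
    (R : Subalgebra ℂ (X → ℂ)) (j : X → ℂ) : Prop where
  comp_smul_mem : ∀ g : G, ∀ f ∈ R, (fun x => f (g • x)) ∈ R
  eq_zero_or_eq_zero : ∀ f ∈ R, ∀ f' ∈ R, f * f' = 0 → f = 0 ∨ f' = 0
  mem : j ∈ R
  apply_smul : ∀ (g : G) x, j (g • x) = j x
  exists_eval : ∀ f ∈ R, (∀ (g : G) x, f (g • x) = f x) →
    ∃ P : Polynomial ℂ, ∀ x, f x = P.eval (j x)
  surjective : Function.Surjective j

/-- The algebra of functions on `X ^ ι` generated by the functions in `R` of one coordinate. -/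
def coordAlg (ι : Type*) {X : Type*} (R : Subalgebra ℂ (X → ℂ)) : Subalgebra ℂ ((ι → X) → ℂ) :=
  Algebra.adjoin ℂ {F | ∃ k : ι, ∃ f ∈ R, F = fun x => f (x k)}

variable {ι X G : Type*} {R : Subalgebra ℂ (X → ℂ)} {j : X → ℂ}

theorem coord_mem_coordAlg (k : ι) {f : X → ℂ} (hf : f ∈ R) :
    (fun x : ι → X => f (x k)) ∈ coordAlg ι R :=
  Algebra.subset_adjoin ⟨k, f, hf, rfl⟩

theorem slice_mem [DecidableEq ι] {F : (ι → X) → ℂ} (hF : F ∈ coordAlg ι R) (x : ι → X) (i : ι) :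
    (fun t => F (Function.update x i t)) ∈ R := by
  induction hF using Algebra.adjoin_induction with
  | mem F hF =>
    obtain ⟨k, f, hf, rfl⟩ := hF
    by_cases hk : k = i
    · subst hk
      simpa using hf
    · simp only [Function.update_of_ne hk]
      exact R.algebraMap_mem (f (x k))
  | algebraMap c => exact R.algebraMap_mem c
  | add F F' _ _ h h' => exact R.add_mem h h'
  | mul F F' _ _ h h' => exact R.mul_mem h h'

section

variable [Group G] [MulAction G X]

/-- The algebra of functions on `X ^ ι` is again a domain: points at which two nonzero functions
do not vanish can be moved together, one coordinate at a time. -/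
theorem IsInvariantDomain.coordAlg_eq_zero_or_eq_zero [Finite ι] (h : IsInvariantDomain G R j)
    {F F' : (ι → X) → ℂ} (hF : F ∈ coordAlg ι R) (hF' : F' ∈ coordAlg ι R) (hFF' : F * F' = 0) :
    F = 0 ∨ F' = 0 := by
  classical
  cases nonempty_fintype ι
  by_contra! hne
  obtain ⟨a, ha⟩ := Function.ne_iff.1 hne.1
  obtain ⟨b, hb⟩ := Function.ne_iff.1 hne.2
  have key : ∀ s : Finset ι, ∃ a b : ι → X, (∀ k ∈ s, a k = b k) ∧ F a ≠ 0 ∧ F' b ≠ 0 := by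
    intro s
    induction s using Finset.induction_on with
    | empty => exact ⟨a, b, by simp, ha, hb⟩
    | insert i s hi ih =>
      obtain ⟨a, b, hab, ha, hb⟩ := ih
      have h1 : (fun t => F (Function.update a i t)) ≠ 0 :=
        fun h0 => ha (by simpa using congrFun h0 (a i))
      have h2 : (fun t => F' (Function.update b i t)) ≠ 0 :=
        fun h0 => hb (by simpa using congrFun h0 (b i))
      have h3 : (fun t => F (Function.update a i t)) * (fun t => F' (Function.update b i t)) ≠ 0 :=
        fun h0 => (h.eq_zero_or_eq_zero _ (slice_mem hF a i) _ (slice_mem hF' b i) h0).elim h1 h2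
      obtain ⟨t, ht⟩ := Function.ne_iff.1 h3
      refine ⟨Function.update a i t, Function.update b i t, ?_, left_ne_zero_of_mul ht,
        right_ne_zero_of_mul ht⟩
      intro k hk
      by_cases hki : k = i
      · subst hki
        simp
      · rw [Function.update_of_ne hki, Function.update_of_ne hki]
        exact hab k ((Finset.mem_insert.1 hk).resolve_left hki)
  obtain ⟨a, b, hab, ha, hb⟩ := key Finset.univ
  obtain rfl : a = b := funext fun k => hab k (Finset.mem_univ k)
  exact mul_ne_zero ha hb (congrFun hFF' a)

theorem IsInvariantDomain.isDomain_coordAlg [Finite ι] (h : IsInvariantDomain G R j) :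
    IsDomain (coordAlg ι R) := by
  have : NoZeroDivisors (coordAlg ι R) := ⟨fun {a b} hab => by
    refine (h.coordAlg_eq_zero_or_eq_zero a.2 b.2 (congrArg Subtype.val hab)).imp ?_ ?_ <;>
    exact fun h => Subtype.ext h⟩
  have : Nontrivial (coordAlg ι R) :=
    ⟨0, 1, fun h01 => zero_ne_one (congrFun (congrArg Subtype.val h01)
      fun _ => (h.surjective 0).choose)⟩
  exact NoZeroDivisors.to_isDomain _

theorem IsInvariantDomain.comp_smul_mem_coordAlg (h : IsInvariantDomain G R j) (g : ι → G)
    {F : (ι → X) → ℂ} (hF : F ∈ coordAlg ι R) : (fun x => F (g • x)) ∈ coordAlg ι R := by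
  induction hF using Algebra.adjoin_induction with
  | mem F hF =>
    obtain ⟨k, f, hf, rfl⟩ := hF
    exact coord_mem_coordAlg k (h.comp_smul_mem (g k) f hf)
  | algebraMap c => exact (coordAlg ι R).algebraMap_mem c
  | add F F' _ _ h h' => exact (coordAlg ι R).add_mem h h'
  | mul F F' _ _ h h' => exact (coordAlg ι R).mul_mem h h'

/-- The sum over `G ^ ι` of the translates of a function is a polynomial in the `j (x k)`: it is
enough to see this for a product of functions of one coordinate. -/
theorem IsInvariantDomain.exists_sum_smul_eq [Fintype ι] [Fintype G] (h : IsInvariantDomain G R j)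
    {F : (ι → X) → ℂ} (hF : F ∈ coordAlg ι R) [Fintype (ι → G)] :
    ∃ P : MvPolynomial ι ℂ, ∀ x : ι → X, ∑ g : ι → G, F (g • x) = aeval (fun k => j (x k)) P := by
  classical
  have hspan : F ∈ Submodule.span ℂ {F : (ι → X) → ℂ | ∃ f : ι → X → ℂ, (∀ k, f k ∈ R) ∧
      F = fun x => ∏ k, f k (x k)} := by
    rw [← Subalgebra.mem_toSubmodule, coordAlg, Algebra.adjoin_eq_span] at hF
    refine Submodule.span_mono ?_ hF
    clear hF
    intro F hF
    rw [SetLike.mem_coe] at hF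
    induction hF using Submonoid.closure_induction with
    | mem F hF =>
      obtain ⟨k, f, hf, rfl⟩ := hF
      refine ⟨fun l => if l = k then f else 1, fun l => ?_, ?_⟩
      · dsimp only
        split_ifs
        exacts [hf, R.one_mem]
      · ext x
        rw [Finset.prod_eq_single k] <;> simp +contextual
    | one => exact ⟨1, fun k => R.one_mem, by ext; simp⟩
    | mul F F' _ _ h h' =>
      obtain ⟨f, hf, rfl⟩ := h
      obtain ⟨f', hf', rfl⟩ := h'
      exact ⟨f * f', fun k => R.mul_mem (hf k) (hf' k), by ext; simp [Finset.prod_mul_distrib]⟩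
  clear hF
  induction hspan using Submodule.span_induction with
  | mem F hF =>
    obtain ⟨f, hf, rfl⟩ := hF
    have hk : ∀ k, ∃ P : Polynomial ℂ, ∀ x, ∑ g : G, f k (g • x) = P.eval (j x) := by
      intro k
      refine h.exists_eval (fun x => ∑ g : G, f k (g • x)) ?_ fun g x => ?_
      · have : (fun x => ∑ g : G, f k (g • x)) = ∑ g : G, fun x => f k (g • x) := by
          ext x
          simp
        rw [this]
        exact R.sum_mem fun g _ => h.comp_smul_mem g _ (hf k)
      · simp only [smul_smul]
        exact Fintype.sum_equiv (Equiv.mulRight g) _ _ fun _ => rfl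
    choose P hP using hk
    refine ⟨∏ k, Polynomial.aeval (MvPolynomial.X k) (P k), fun x => ?_⟩
    rw [map_prod]
    have : ∀ k, aeval (fun k => j (x k))
        (Polynomial.aeval (MvPolynomial.X k) (P k) : MvPolynomial ι ℂ) =
        ∑ g : G, f k (g • x k) := by
      intro k
      rw [hP, ← Polynomial.aeval_algHom_apply, aeval_X, Polynomial.coe_aeval_eq_eval]
    rw [Finset.prod_congr rfl fun k _ => this k, Finset.prod_univ_sum, Fintype.piFinset_univ]
    exact Finset.sum_congr (by ext; simp) fun g _ => rfl
  | zero => exact ⟨0, by simp⟩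
  | add F F' _ _ h h' =>
    obtain ⟨P, hP⟩ := h
    obtain ⟨P', hP'⟩ := h'
    exact ⟨P + P', fun x => by simp [Finset.sum_add_distrib, hP, hP']⟩
  | smul c F _ h =>
    obtain ⟨P, hP⟩ := h
    exact ⟨c • P, fun x => by simp [← Finset.mul_sum, hP]⟩

/-- The invariants of `G ^ ι` are the polynomials in the `j (x k)`, by averaging over `G ^ ι`. -/
theorem IsInvariantDomain.exists_eq_aeval [Finite ι] [Finite G] (h : IsInvariantDomain G R j)
    {F : (ι → X) → ℂ} (hF : F ∈ coordAlg ι R) (hinv : ∀ (g : ι → G) x, F (g • x) = F x) :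
    ∃ P : MvPolynomial ι ℂ, ∀ x : ι → X, F x = aeval (fun k => j (x k)) P := by
  classical
  cases nonempty_fintype ι
  cases nonempty_fintype G
  obtain ⟨P, hP⟩ := h.exists_sum_smul_eq hF
  refine ⟨C (Fintype.card (ι → G) : ℂ)⁻¹ * P, fun x => ?_⟩
  have h0 : (Fintype.card (ι → G) : ℂ) ≠ 0 := Nat.cast_ne_zero.2 Fintype.card_ne_zero
  rw [map_mul, aeval_C, ← hP x, Finset.sum_congr rfl fun g _ => hinv g x, Finset.sum_const,
    Finset.card_univ, nsmul_eq_mul]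
  exact (inv_mul_cancel_left₀ h0 (F x)).symm

/-- The action of `G ^ ι` on the algebra of functions on `X ^ ι`. -/
@[reducible] def IsInvariantDomain.action (h : IsInvariantDomain G R j) :
    MulSemiringAction (ι → G) (coordAlg ι R) where
  smul g F := ⟨fun x => F.1 (g⁻¹ • x), h.comp_smul_mem_coordAlg g⁻¹ F.2⟩
  one_smul F := Subtype.ext (funext fun x => by
    change F.1 ((1 : ι → G)⁻¹ • x) = _
    rw [inv_one, one_smul])
  mul_smul g g' F := Subtype.ext (funext fun x => by
    change F.1 ((g * g')⁻¹ • x) = F.1 (g'⁻¹ • g⁻¹ • x)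
    rw [mul_inv_rev, mul_smul])
  smul_zero _ := rfl
  smul_add _ _ _ := rfl
  smul_one _ := rfl
  smul_mul _ _ _ := rfl

/-- The polynomial ring as a ring of functions on `X ^ ι`, by composition with `j`. -/
@[reducible] def IsInvariantDomain.algebra (ι : Type*) (h : IsInvariantDomain G R j) :
    Algebra (MvPolynomial ι ℂ) (coordAlg ι R) :=
  (aeval (R := ℂ) (fun k => (⟨fun x => j (x k), coord_mem_coordAlg k h.mem⟩ :
    coordAlg ι R))).toAlgebra

theorem IsInvariantDomain.algebraMap_apply (h : IsInvariantDomain G R j) (P : MvPolynomial ι ℂ)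
    (x : ι → X) : letI := h.algebra ι
    (algebraMap (MvPolynomial ι ℂ) (coordAlg ι R) P).1 x = aeval (fun k => j (x k)) P := by
  let ev : coordAlg ι R →ₐ[ℂ] ℂ := (Pi.evalAlgHom ℂ (fun _ : ι → X => ℂ) x).comp (coordAlg ι R).val
  change ev (aeval _ P) = _
  rw [← AlgHom.comp_apply, comp_aeval]
  rfl

theorem IsInvariantDomain.smulCommClass (h : IsInvariantDomain G R j) :
    letI := h.algebra ι
    letI := h.action (ι := ι)
    SMulCommClass (ι → G) (MvPolynomial ι ℂ) (coordAlg ι R) := by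
  let := h.algebra ι
  let := h.action (ι := ι)
  refine ⟨fun g P F => ?_⟩
  rw [Algebra.smul_def, Algebra.smul_def, smul_mul']
  congr 1
  refine Subtype.ext (funext fun x => ?_)
  change (algebraMap (MvPolynomial ι ℂ) (coordAlg ι R) P).1 (g⁻¹ • x) = _
  rw [h.algebraMap_apply, h.algebraMap_apply]
  simp only [Pi.smul_apply', h.apply_smul]

theorem IsInvariantDomain.isInvariant [Finite ι] [Finite G] (h : IsInvariantDomain G R j) :
    letI := h.algebra ι
    letI := h.action (ι := ι)
    Algebra.IsInvariant (MvPolynomial ι ℂ) (coordAlg ι R) (ι → G) := by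
  let := h.algebra ι
  let := h.action (ι := ι)
  refine ⟨fun F hF => ?_⟩
  obtain ⟨P, hP⟩ := h.exists_eq_aeval F.2 fun g x => by
    have := congrFun (congrArg Subtype.val (hF g⁻¹)) x
    change F.1 (g⁻¹⁻¹ • x) = F.1 x at this
    rwa [inv_inv] at this
  refine ⟨P, Subtype.ext (funext fun x => ?_)⟩
  rw [h.algebraMap_apply, hP]

end

/-! ### Irreducibility from a stable prime -/

/-- Irreducibility in terms of the polynomials vanishing on the set. -/
theorem isZariskiIrreducible_of_mul {σ : Type} {W : Set (σ → ℂ)} (hne : W.Nonempty)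
    (h : ∀ p q : MvPolynomial σ ℂ, (∀ w ∈ W, aeval w p * aeval w q = 0) →
      (∀ w ∈ W, aeval w p = 0) ∨ ∀ w ∈ W, aeval w q = 0) : IsZariskiIrreducible W := by
  refine ⟨hne, (@isPreirreducible_iff_isClosed_union_isClosed _ (zariskiTopology σ) W).2 ?_⟩
  intro Z₁ Z₂ h₁ h₂ hW
  obtain ⟨I₁, rfl⟩ := (isClosed_zariski_iff _).1 h₁
  obtain ⟨I₂, rfl⟩ := (isClosed_zariski_iff _).1 h₂
  by_contra! hcon
  obtain ⟨w₁, hw₁, h₁⟩ := Set.not_subset.1 hcon.1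
  obtain ⟨w₂, hw₂, h₂⟩ := Set.not_subset.1 hcon.2
  simp only [mem_zeroLocus_iff, not_forall] at h₁ h₂
  obtain ⟨p, hp, hpw⟩ := h₁
  obtain ⟨q, hq, hqw⟩ := h₂
  refine (h p q fun w hw => ?_).elim (fun h => hpw (h _ hw₁)) fun h => hqw (h _ hw₂)
  rcases hW hw with h | h
  · rw [mem_zeroLocus_iff.1 h p hp, zero_mul]
  · rw [mem_zeroLocus_iff.1 h q hq, mul_zero]

theorem map_charpoly_eq_X_pow {B 𝒢 : Type*} [CommRing B] [Group 𝒢] [Fintype 𝒢]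
    [MulSemiringAction 𝒢 B] (Q : Ideal B) (b : B) (hb : ∀ g : 𝒢, g • b ∈ Q) :
    (MulSemiringAction.charpoly 𝒢 b).map (Ideal.Quotient.mk Q) =
      Polynomial.X ^ Fintype.card 𝒢 := by
  rw [MulSemiringAction.charpoly_eq, Polynomial.map_prod,
    Finset.prod_congr rfl fun g _ => show Polynomial.map _ _ = Polynomial.X by
      rw [Polynomial.map_sub, Polynomial.map_X, Polynomial.map_C,
        Ideal.Quotient.eq_zero_iff_mem.2 (hb g), Polynomial.C_0, sub_zero],
    Finset.prod_const, Finset.card_univ]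

section

variable {σ : Type} [Finite σ] [Group G] [Finite G] [MulAction G X]

/-- If the prime `Q` over the ideal of `Z` is stable under `G ^ σ`, then every `F ∈ Q` vanishes
above `Z`: modulo `Q`, the product of all `T - g • F` is a power of `T`, so its coefficients other
than the leading one, being invariant, lie in the ideal of `Z`. -/
theorem IsInvariantDomain.apply_eq_zero (h : IsInvariantDomain G R j) {Z : Set (σ → ℂ)}
    (Q : Ideal (coordAlg σ R)) [Q.IsPrime]
    (hQ : letI := h.algebra σ; Q.LiesOver (vanishingIdeal ℂ Z))
    (hstab : letI := h.action (ι := σ); ∀ g : σ → G, ∀ F ∈ Q, g • F ∈ Q)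
    (F : coordAlg σ R) (hF : F ∈ Q) (x : σ → X)
    (hx : (fun k => j (x k)) ∈ Z) : F.1 x = 0 := by
  let := h.algebra σ
  let := h.action (ι := σ)
  have := h.isInvariant (ι := σ)
  classical
  cases nonempty_fintype (σ → G)
  let ev : coordAlg σ R →+* ℂ :=
    ((Pi.evalAlgHom ℂ (fun _ : σ → X => ℂ) x).comp (coordAlg σ R).val).toRingHom
  set N := Fintype.card (σ → G) with hN
  set c := MulSemiringAction.charpoly (σ → G) F with hc
  have hcQ : c.map (Ideal.Quotient.mk Q) = Polynomial.X ^ N :=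
    map_charpoly_eq_X_pow Q F fun g => hstab g F hF
  have hcoeff : ∀ k, k ≠ N → ev (c.coeff k) = 0 := by
    intro k hk
    obtain ⟨a, ha⟩ := Algebra.IsInvariant.isInvariant (A := MvPolynomial σ ℂ) (G := σ → G)
      (c.coeff k) fun g => MulSemiringAction.smul_coeff_charpoly F k g
    have hmem : c.coeff k ∈ Q := by
      rw [← Ideal.Quotient.eq_zero_iff_mem, ← Polynomial.coeff_map, hcQ, Polynomial.coeff_X_pow,
        if_neg hk]
    rw [← ha] at hmem ⊢
    have ha' : a ∈ vanishingIdeal ℂ Z := by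
      rw [hQ.over]
      exact hmem
    exact (h.algebraMap_apply a x).trans (ha' _ hx)
  have hmonic : c.coeff N = 1 := by
    have hm := MulSemiringAction.monic_charpoly (σ → G) F
    have hd : c.natDegree = N := by
      have := (hm.natDegree_map (Ideal.Quotient.mk Q))
      rw [← hc, hcQ, Polynomial.natDegree_X_pow] at this
      exact this.symm
    rw [← hd]
    exact hm
  have hmap : c.map ev = Polynomial.X ^ N := by
    ext k
    rw [Polynomial.coeff_map, Polynomial.coeff_X_pow]
    split_ifs with hk
    · rw [hk, hmonic, map_one]
    · exact hcoeff k hk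
  have h0 : (c.map ev).eval (ev F) = 0 := by
    rw [Polynomial.eval_map, Polynomial.eval₂_hom, MulSemiringAction.eval_charpoly, map_zero]
  rw [hmap, Polynomial.eval_pow, Polynomial.eval_X] at h0
  exact (pow_eq_zero_iff Fintype.card_ne_zero).1 h0

/-- If some prime `Q` over the ideal of `Z` is stable under `G ^ σ`, then the image of the preimage
of `Z` in `X ^ σ` under any function `y ∈ R`, applied to all coordinates, is irreducible. -/
theorem IsInvariantDomain.isZariskiIrreducible (h : IsInvariantDomain G R j) {Z : Set (σ → ℂ)}
    (hZ : IsZariskiIrreducible Z) (Q : Ideal (coordAlg σ R)) [Q.IsPrime]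
    (hQ : letI := h.algebra σ; Q.LiesOver (vanishingIdeal ℂ Z))
    (hstab : letI := h.action (ι := σ); ∀ g : σ → G, ∀ F ∈ Q, g • F ∈ Q) {y : X → ℂ} (hy : y ∈ R) :
    IsZariskiIrreducible {w | ∃ x : σ → X, (fun k => j (x k)) ∈ Z ∧ w = fun k => y (x k)} := by
  let := h.algebra σ
  let := h.action (ι := σ)
  have := h.isInvariant (ι := σ)
  classical
  cases nonempty_fintype (σ → G)
  have hlift : ∀ z : σ → ℂ, ∃ x : σ → X, (fun k => j (x k)) = z := fun z =>
    ⟨fun k => (h.surjective (z k)).choose, funext fun k => (h.surjective (z k)).choose_spec⟩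
  let Y : σ → coordAlg σ R := fun k => ⟨fun x => y (x k), coord_mem_coordAlg k hy⟩
  have hY : ∀ (p : MvPolynomial σ ℂ) (x : σ → X),
      (aeval Y p).1 x = aeval (fun k => y (x k)) p := by
    intro p x
    let ev : coordAlg σ R →ₐ[ℂ] ℂ :=
      (Pi.evalAlgHom ℂ (fun _ : σ → X => ℂ) x).comp (coordAlg σ R).val
    change ev (aeval _ p) = _
    rw [← AlgHom.comp_apply, comp_aeval]
    rfl
  refine isZariskiIrreducible_of_mul ?_ fun p q hpq => ?_
  · obtain ⟨z, hz⟩ := hZ.1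
    obtain ⟨x, rfl⟩ := hlift z
    exact ⟨_, x, hz, rfl⟩
  have hnorm : ∀ p : MvPolynomial σ ℂ, ∃ a : MvPolynomial σ ℂ,
      algebraMap (MvPolynomial σ ℂ) (coordAlg σ R) a = ∏ g : σ → G, g • aeval Y p := by
    intro p
    refine Algebra.IsInvariant.isInvariant (G := σ → G) _ fun g => ?_
    rw [Finset.smul_prod']
    simp only [smul_smul]
    exact Fintype.prod_equiv (Equiv.mulLeft g) _ _ fun _ => rfl
  have hfinish : ∀ (p a : MvPolynomial σ ℂ),
      algebraMap (MvPolynomial σ ℂ) (coordAlg σ R) a = ∏ g : σ → G, g • aeval Y p →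
      a ∈ vanishingIdeal ℂ Z →
      ∀ w ∈ {w | ∃ x : σ → X, (fun k => j (x k)) ∈ Z ∧ w = fun k => y (x k)}, aeval w p = 0 := by
    rintro p a ha haZ _ ⟨x, hx, rfl⟩
    rw [hQ.over, Ideal.mem_comap, ha] at haZ
    obtain ⟨g, -, hg⟩ := (Ideal.IsPrime.prod_mem_iff (p := Q)).1 haZ
    have := hstab g⁻¹ _ hg
    rw [inv_smul_smul] at this
    rw [← hY]
    exact h.apply_eq_zero Q hQ hstab _ this x hx
  obtain ⟨a, ha⟩ := hnorm p
  obtain ⟨b, hb⟩ := hnorm q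
  have hab : a * b ∈ vanishingIdeal ℂ Z := by
    intro z hz
    obtain ⟨x, rfl⟩ := hlift z
    rw [← h.algebraMap_apply, map_mul, ha, hb]
    have hsplit : ∀ F : coordAlg σ R,
        ∏ g : σ → G, g • F = F * ∏ g ∈ Finset.univ.erase (1 : σ → G), g • F := by
      intro F
      rw [← Finset.mul_prod_erase _ _ (Finset.mem_univ (1 : σ → G)), one_smul]
    rw [hsplit, hsplit (aeval Y q)]
    change (aeval Y p).1 x * _ * ((aeval Y q).1 x * _) = 0
    rw [hY, hY, mul_mul_mul_comm, hpq _ ⟨x, hz, rfl⟩, zero_mul]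
  exact (hZ.isPrime.mem_or_mem hab).imp (hfinish p a ha) (hfinish q b hb)

end

end

/-! ### Dominant projections of hypersurfaces -/

section

open MvPolynomial

/-- If the projection `Z → ℂ^{σ \ {i}}` is dominant, then a polynomial which does not involve the
variable `i` and vanishes on `Z` is zero. -/
theorem eq_zero_of_mem_vanishingIdeal {σ : Type} [DecidableEq σ] {Z : Set (σ → ℂ)} {i : σ}
    (hdom : IsZariskiDense (proj i '' Z)) {P : MvPolynomial σ ℂ}
    (hP : P ∈ vanishingIdeal ℂ Z)
    (hi : ∀ z : σ → ℂ, aeval (Function.update z i 0) P = aeval z P) : P = 0 := by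
  let P' : MvPolynomial {j : σ // j ≠ i} ℂ := aeval (fun k => if h : k ≠ i then X ⟨k, h⟩ else 0) P
  have hP' : ∀ z : σ → ℂ, aeval (proj i z) P' = aeval z P := by
    intro z
    rw [← hi z, ← AlgHom.comp_apply, comp_aeval]
    congr 2
    ext k
    by_cases hk : k = i
    · subst hk
      simp
    · simp [hk, proj]
  have hcl : @IsClosed _ (zariskiTopology {j : σ // j ≠ i})
      (zeroLocus ℂ (Ideal.span {P'})) := (isClosed_zariski_iff _).2 ⟨_, rfl⟩
  have hsub : proj i '' Z ⊆ zeroLocus ℂ (Ideal.span {P'}) := by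
    rintro _ ⟨z, hz, rfl⟩
    simpa [zeroLocus_span] using (hP' z).trans (hP z hz)
  have huniv : ∀ w, w ∈ zeroLocus ℂ (Ideal.span {P'}) := fun w =>
    (@IsClosed.closure_subset_iff _ (zariskiTopology {j : σ // j ≠ i}) _ _ hcl).2 hsub (hdom w)
  have h0 : ∀ z : σ → ℂ, aeval z P = 0 := by
    intro z
    rw [← hP' z]
    simpa [zeroLocus_span] using huniv (proj i z)
  exact MvPolynomial.funext fun z => by simpa [coe_aeval_eq_eval] using h0 z

open scoped IntermediateField.algebraAdjoinAdjoin in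
theorem isIntegral_adjoin {k E : Type*} [Field k] [Field E] [Algebra k E] {S : Set E} {a : E}
    (ha : IsAlgebraic (Algebra.adjoin k S) a) : IsIntegral (IntermediateField.adjoin k S) a :=
  (ha.extendScalars (FaithfulSMul.algebraMap_injective _ (IntermediateField.adjoin k S))).isIntegral

section

variable {σ : Type} {Z : Set (σ → ℂ)}

/-- A dominant projection of a hypersurface that forgets one coordinate has finite degree: the
coordinates other than the `i`-th one are algebraically independent on `Z`, so a nonzero polynomial
vanishing on `Z` is an algebraic equation for the `i`-th one. -/
theorem finiteDimensional_functionField (hirr : IsZariskiIrreducible Z)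
    (hZ : ∃ f ∈ vanishingIdeal ℂ Z, f ≠ 0) {i : σ} (hdom : IsZariskiDense (proj i '' Z)) :
    haveI : (vanishingIdeal ℂ Z).IsPrime := hirr.isPrime
    FiniteDimensional
      (IntermediateField.adjoin ℂ {g : FractionRing (CoordRing Z) | ∃ j : σ, j ≠ i ∧
        g = algebraMap (CoordRing Z) (FractionRing (CoordRing Z)) (Ideal.Quotient.mk _ (X j))})
      (FractionRing (CoordRing Z)) := by
  classical
  have := hirr.isPrime
  set K := FractionRing (CoordRing Z)
  let x : σ → K := fun j => algebraMap (CoordRing Z) K (Ideal.Quotient.mk _ (X j))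
  have hx : ∀ p : MvPolynomial σ ℂ,
      aeval x p = algebraMap (CoordRing Z) K (Ideal.Quotient.mk _ p) := by
    intro p
    have : aeval x = (IsScalarTower.toAlgHom ℂ (CoordRing Z) K).comp
        (Ideal.Quotient.mkₐ ℂ (vanishingIdeal ℂ Z)) := by
      ext j
      simp [x]
    rw [this]
    rfl
  have hx0 : ∀ p : MvPolynomial σ ℂ, aeval x p = 0 → p ∈ vanishingIdeal ℂ Z := by
    intro p hp
    rw [hx, FaithfulSMul.algebraMap_eq_zero_iff] at hp
    exact Ideal.Quotient.eq_zero_iff_mem.1 hp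
  set S : Set K := {g : K | ∃ j : σ, j ≠ i ∧ g = algebraMap (CoordRing Z) K
    (Ideal.Quotient.mk _ (X j))} with hS
  have hSx : x '' {i}ᶜ = S := by
    ext g
    simp [hS, x, eq_comm]
  have hind : AlgebraicIndepOn ℂ x {i}ᶜ := by
    refine algebraicIndependent_iff.2 fun p hp => ?_
    have h1 : aeval x (rename Subtype.val p) = 0 := by
      rw [aeval_rename]
      exact hp
    have h2 := eq_zero_of_mem_vanishingIdeal hdom (hx0 _ h1) fun z => by
      rw [aeval_rename, aeval_rename]
      congr 2
      ext ⟨k, hk⟩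
      exact Function.update_of_ne hk _ _
    exact rename_injective _ Subtype.val_injective (h2.trans (map_zero _).symm)
  have halg : IsAlgebraic (Algebra.adjoin ℂ S) (x i) := by
    by_contra htr
    rw [← hSx] at htr
    have h1 := hind.insert htr
    obtain ⟨f, hf, hf0⟩ := hZ
    have h2 : aeval x f = 0 := by
      rw [hx, Ideal.Quotient.eq_zero_iff_mem.2 hf, map_zero]
    let e : σ → (insert i {i}ᶜ : Set σ) := fun k => ⟨k, by
      by_cases hk : k = i <;> simp [hk]⟩
    have h3 := h1.comp e fun a b h => congrArg Subtype.val h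
    exact hf0 ((algebraicIndependent_iff.1 h3) f h2)
  have hint : IsIntegral (IntermediateField.adjoin ℂ S) (x i) := isIntegral_adjoin halg
  have hfin := IntermediateField.adjoin.finiteDimensional hint
  set F := IntermediateField.adjoin ℂ S
  have hmem : ∀ k, x k ∈ IntermediateField.adjoin F {x i} := by
    intro k
    by_cases hk : k = i
    · subst hk
      exact IntermediateField.mem_adjoin_simple_self F _
    · exact IntermediateField.algebraMap_mem (IntermediateField.adjoin F {x i})
        (⟨x k, IntermediateField.subset_adjoin ℂ S ⟨k, hk, rfl⟩⟩ : F)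
  have hmem' : ∀ p : MvPolynomial σ ℂ, aeval x p ∈ IntermediateField.adjoin F {x i} := by
    intro p
    induction p using MvPolynomial.induction_on with
    | C c =>
      rw [aeval_C]
      exact IntermediateField.algebraMap_mem (IntermediateField.adjoin F {x i})
        (algebraMap ℂ F c)
    | add p q hp hq =>
      rw [map_add]
      exact add_mem hp hq
    | mul_X p k hp =>
      rw [map_mul, aeval_X]
      exact mul_mem hp (hmem k)
  have htop : IntermediateField.adjoin F {x i} = ⊤ := by
    refine eq_top_iff.2 fun z _ => ?_
    obtain ⟨a, b, -, rfl⟩ := IsFractionRing.div_surjective (CoordRing Z) z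
    obtain ⟨a, rfl⟩ := Ideal.Quotient.mk_surjective a
    obtain ⟨b, rfl⟩ := Ideal.Quotient.mk_surjective b
    rw [← hx, ← hx]
    exact div_mem (hmem' a) (hmem' b)
  rw [htop] at hfin
  exact Module.Finite.equiv (IntermediateField.topEquiv (F := F) (E := K)).toLinearEquiv

end

section

variable {σ X G : Type} [Group G] [MulAction G X]
  {R : Subalgebra ℂ (X → ℂ)} {j : X → ℂ}

/-- The functions on `X ^ σ` which do not depend on the `i`-th coordinate. -/
def eraseSubring [DecidableEq σ] (R : Subalgebra ℂ (X → ℂ)) (i : σ) : Subring (coordAlg σ R) where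
  carrier := {F | ∀ x t, F.1 (Function.update x i t) = F.1 x}
  mul_mem' ha hb x t := congrArg₂ (· * ·) (ha x t) (hb x t)
  one_mem' _ _ := rfl
  add_mem' ha hb x t := congrArg₂ (· + ·) (ha x t) (hb x t)
  zero_mem' _ _ := rfl
  neg_mem' ha x t := congrArg (- ·) (ha x t)

theorem IsInvariantDomain.smul_mem_eraseSubring [DecidableEq σ] (h : IsInvariantDomain G R j)
    (i : σ) : letI := h.action (ι := σ)
    ∀ g : σ → G, ∀ F ∈ eraseSubring R i, g • F ∈ eraseSubring R i := by
  intro g F hF x t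
  change F.1 (g⁻¹ • Function.update x i t) = F.1 (g⁻¹ • x)
  have : g⁻¹ • Function.update x i t = Function.update (g⁻¹ • x) i ((g i)⁻¹ • t) := by
    ext k
    by_cases hk : k = i
    · subst hk
      simp
    · simp [hk]
  rw [this]
  exact hF _ _

/-- If the projection forgetting the `i`-th coordinate is dominant on `Z`, no nonzero function
independent of the `i`-th coordinate lies in a prime over the ideal of `Z`: its norm would be a
polynomial vanishing on `Z`. -/
theorem IsInvariantDomain.eq_zero_of_mem_eraseSubring [Finite σ] [Finite G]
    [DecidableEq σ] (h : IsInvariantDomain G R j)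
    {Z : Set (σ → ℂ)} {i : σ} (hdom : IsZariskiDense (proj i '' Z)) (Q : Ideal (coordAlg σ R))
    (hQ : letI := h.algebra σ; Q.LiesOver (vanishingIdeal ℂ Z)) (F : coordAlg σ R)
    (hF : F ∈ eraseSubring R i) (hFQ : F ∈ Q) : F = 0 := by
  let := h.algebra σ
  let := h.action (ι := σ)
  have := h.isInvariant (ι := σ)
  have : DecidableEq (σ → G) := Classical.decEq _
  cases nonempty_fintype (σ → G)
  have hlift : ∀ z : σ → ℂ, ∃ x : σ → X, (fun k => j (x k)) = z := fun z =>
    ⟨fun k => (h.surjective (z k)).choose, funext fun k => (h.surjective (z k)).choose_spec⟩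
  obtain ⟨a, ha⟩ := Algebra.IsInvariant.isInvariant (A := MvPolynomial σ ℂ) (G := σ → G)
    (∏ g : σ → G, g • F) fun g => by
      rw [Finset.smul_prod']
      simp only [smul_smul]
      exact Fintype.prod_equiv (Equiv.mulLeft g) _ _ fun _ => rfl
  have hE : ∏ g : σ → G, g • F ∈ eraseSubring R i :=
    Subring.prod_mem _ fun g _ => h.smul_mem_eraseSubring i g F hF
  have haQ : a ∈ vanishingIdeal ℂ Z := by
    rw [hQ.over, Ideal.mem_comap, ha, ← Finset.mul_prod_erase _ _ (Finset.mem_univ (1 : σ → G)),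
      one_smul]
    exact Ideal.mul_mem_right _ _ hFQ
  have ha0 : a = 0 := by
    refine eq_zero_of_mem_vanishingIdeal hdom haQ fun z => ?_
    obtain ⟨x, rfl⟩ := hlift z
    obtain ⟨t, ht⟩ := h.surjective 0
    have : Function.update (fun k => j (x k)) i 0 = fun k => j (Function.update x i t k) := by
      ext k
      by_cases hk : k = i
      · subst hk
        simp [ht]
      · simp [hk]
    rw [this, ← h.algebraMap_apply, ← h.algebraMap_apply, ha]
    exact hE x t
  rw [ha0, map_zero] at ha
  have := h.isDomain_coordAlg (ι := σ)
  obtain ⟨g, -, hg⟩ := Finset.prod_eq_zero_iff.1 ha.symm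
  rwa [smul_eq_zero_iff_eq] at hg

end

end

/-! ### The decomposition group of a prime over a hypersurface -/

section

open MvPolynomial
open scoped Pointwise

theorem smul_mem_of_mem_stabilizer {B 𝒢 : Type*} [CommRing B] [Group 𝒢] [MulSemiringAction 𝒢 B]
    {Q : Ideal B} {g : 𝒢} (hg : g ∈ MulAction.stabilizer 𝒢 Q) {b : B} (hb : b ∈ Q) : g • b ∈ Q := by
  have := Ideal.smul_mem_pointwise_smul g b Q hb
  rwa [MulAction.mem_stabilizer_iff.1 hg] at this

section

variable {σ X G : Type} [Group G] [MulAction G X]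
  {R : Subalgebra ℂ (X → ℂ)} {j : X → ℂ}

/-- The subgroup of the elements of `G ^ σ` which agree, except possibly at `i`, with an element
of `D`. -/
def eraseSubgroup (D : Subgroup (σ → G)) (i : σ) : Subgroup (σ → G) where
  carrier := {g | ∃ d ∈ D, ∀ k, k ≠ i → d k = g k}
  mul_mem' := by
    rintro g g' ⟨d, hd, h⟩ ⟨d', hd', h'⟩
    exact ⟨d * d', D.mul_mem hd hd', fun k hk => congrArg₂ (· * ·) (h k hk) (h' k hk)⟩
  one_mem' := ⟨1, D.one_mem, fun _ _ => rfl⟩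
  inv_mem' := by
    rintro g ⟨d, hd, h⟩
    exact ⟨d⁻¹, D.inv_mem hd, fun k hk => congrArg (·⁻¹) (h k hk)⟩

/-- The decomposition group in `G ^ σ` of an ideal of the algebra of functions on `X ^ σ`. -/
def IsInvariantDomain.decompositionGroup (h : IsInvariantDomain G R j)
    (Q : Ideal (coordAlg σ R)) : Subgroup (σ → G) :=
  letI := h.action (ι := σ)
  letI : MulAction (σ → G) (Ideal (coordAlg σ R)) :=
    Ideal.pointwiseDistribMulAction.toMulAction
  MulAction.stabilizer (σ → G) Q

/-- The decomposition group of a prime over the ideal of `Z` surjects to the product of the copies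
of `G` other than the `i`-th one, up to a subgroup of index at most the degree of the `i`-th
projection. -/
theorem IsInvariantDomain.index_eraseSubgroup_le [Finite σ] [Finite G]
    (h : IsInvariantDomain G R j)
    {Z : Set (σ → ℂ)} (hirr : IsZariskiIrreducible Z) (hZ : ∃ f ∈ vanishingIdeal ℂ Z, f ≠ 0)
    {i : σ} (hdom : IsZariskiDense (proj i '' Z)) (Q : Ideal (coordAlg σ R)) [Q.IsPrime]
    (hQ : letI := h.algebra σ; Q.LiesOver (vanishingIdeal ℂ Z)) :
    (eraseSubgroup (h.decompositionGroup Q) i).index ≤ projDegree Z hirr i := by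
  classical
  let := h.algebra σ
  let := h.action (ι := σ)
  have := h.isInvariant (ι := σ)
  have := h.smulCommClass (ι := σ)
  have := hirr.isPrime
  have := finiteDimensional_functionField hirr hZ hdom
  have : Algebra.IsIntegral (MvPolynomial σ ℂ) (coordAlg σ R) :=
    Algebra.IsInvariant.isIntegral _ _ (σ → G)
  let := FractionRing.liftAlgebra (CoordRing Z) (FractionRing (coordAlg σ R ⧸ Q))
  have := FractionRing.isScalarTower_liftAlgebra (CoordRing Z) (FractionRing (coordAlg σ R ⧸ Q))
  refine index_le_finrank (𝒢 := σ → G) (vanishingIdeal ℂ Z) Q (FractionRing (CoordRing Z))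
    (FractionRing (coordAlg σ R ⧸ Q)) _ (eraseSubring R i) (h.smul_mem_eraseSubring i)
    (h.eq_zero_of_mem_eraseSubring hdom Q hQ) ?_ _ ?_
  · have key : ∀ r ∈ Algebra.adjoin ℂ {g : FractionRing (CoordRing Z) | ∃ j : σ, j ≠ i ∧
        g = algebraMap (CoordRing Z) (FractionRing (CoordRing Z))
          (Ideal.Quotient.mk _ (MvPolynomial.X j))},
        ∃ a : MvPolynomial σ ℂ, algebraMap _ (coordAlg σ R) a ∈ eraseSubring R i ∧
          r = algebraMap (CoordRing Z) (FractionRing (CoordRing Z)) (Ideal.Quotient.mk _ a) := by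
      intro r hr
      induction hr using Algebra.adjoin_induction with
      | mem r hr =>
        obtain ⟨k, hk, rfl⟩ := hr
        refine ⟨MvPolynomial.X k, fun x t => ?_, rfl⟩
        rw [h.algebraMap_apply, h.algebraMap_apply, aeval_X, aeval_X, Function.update_of_ne hk]
      | algebraMap c =>
        refine ⟨C c, fun x t => ?_, rfl⟩
        rw [h.algebraMap_apply, h.algebraMap_apply, aeval_C, aeval_C]
      | add r s _ _ hr hs =>
        obtain ⟨a, ha, rfl⟩ := hr
        obtain ⟨b, hb, rfl⟩ := hs
        exact ⟨a + b, by rw [map_add]; exact add_mem ha hb, by rw [map_add, map_add]⟩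
      | mul r s _ _ hr hs =>
        obtain ⟨a, ha, rfl⟩ := hr
        obtain ⟨b, hb, rfl⟩ := hs
        exact ⟨a * b, by rw [map_mul]; exact mul_mem ha hb, by rw [map_mul, map_mul]⟩
    intro x
    obtain ⟨r, hr, s, hs, hrs⟩ := IntermediateField.mem_adjoin_iff_div.1 x.2
    obtain ⟨a, ha, rfl⟩ := key r hr
    obtain ⟨b, hb, rfl⟩ := key s hs
    exact ⟨a, b, ha, hb, hrs⟩
  · intro g d hd hdg
    -- `d⁻¹ * g` acts trivially on the functions of the other coordinates; correcting it at `i`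
    -- gives an element which acts trivially on everything.
    set e : σ → G := Function.update (d⁻¹ * g) i 1 with he
    have htriv : ∀ F ∈ coordAlg σ R, ∀ x, F (e⁻¹ • x) = F x := by
      intro F hF
      induction hF using Algebra.adjoin_induction with
      | mem F hF =>
        obtain ⟨k, f, hf, rfl⟩ := hF
        intro x
        by_cases hk : k = i
        · subst hk
          simp [he]
        · have h1 := hdg ⟨_, coord_mem_coordAlg k hf⟩ fun x t => by
            simp only [Function.update_of_ne hk]
          have h2 := congrFun (congrArg Subtype.val h1) (d • x)
          change f ((d k)⁻¹ • d k • x k) = f ((g k)⁻¹ • d k • x k) at h2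
          rw [inv_smul_smul] at h2
          change f ((e k)⁻¹ • x k) = f (x k)
          rw [h2, he, Function.update_of_ne hk, Pi.mul_apply, Pi.inv_apply, mul_inv_rev, inv_inv,
            mul_smul]
      | algebraMap c => exact fun x => rfl
      | add F F' _ _ h h' => exact fun x => congrArg₂ (· + ·) (h x) (h' x)
      | mul F F' _ _ h h' => exact fun x => congrArg₂ (· * ·) (h x) (h' x)
    have he' : e ∈ MulAction.stabilizer (σ → G) Q := by
      rw [MulAction.mem_stabilizer_iff]
      have h1 : ∀ F : coordAlg σ R, e • F = F := fun F =>
        Subtype.ext (funext fun x => htriv F.1 F.2 x)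
      ext F
      rw [Ideal.mem_pointwise_smul_iff_inv_smul_mem]
      rw [show e⁻¹ • F = F by rw [inv_smul_eq_iff, h1]]
    refine ⟨d * e, mul_mem hd he', fun k hk => ?_⟩
    rw [Pi.mul_apply, he, Function.update_of_ne hk, Pi.mul_apply, Pi.inv_apply,
      mul_inv_cancel_left]

/-- If `G` is perfect and generated by elements of order dividing `m`, and all prime divisors of `m`
are larger than the degrees of the projections, the decomposition group of a prime over the ideal
of `Z` is the whole group. -/
theorem IsInvariantDomain.decompositionGroup_eq_top [Finite σ] [Finite G]
    (h : IsInvariantDomain G R j)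
    (hσ : 3 ≤ Nat.card σ) {Z : Set (σ → ℂ)} (hZ : ∃ f ∈ vanishingIdeal ℂ Z, f ≠ 0)
    (hirr : IsZariskiIrreducible Z) (hdom : ∀ i, IsZariskiDense (proj i '' Z)) {m : ℕ}
    (hperf : commutator G = ⊤) (hgen : Subgroup.closure {u : G | u ^ m = 1} = ⊤)
    (hl : ∀ l : ℕ, l.Prime → l ∣ m → ∀ i, projDegree Z hirr i < l)
    (Q : Ideal (coordAlg σ R)) [Q.IsPrime]
    (hQ : letI := h.algebra σ; Q.LiesOver (vanishingIdeal ℂ Z)) :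
    h.decompositionGroup Q = ⊤ := by
  cases nonempty_fintype σ
  refine pi_eq_top_of_forall_erase (by rwa [← Nat.card_eq_fintype_card]) hperf _ fun i g => ?_
  have htop : eraseSubgroup (h.decompositionGroup Q) i = ⊤ :=
    pi_eq_top_of_index_lt hgen _ Subgroup.FiniteIndex.index_ne_zero fun l hlp hlm =>
      (h.index_eraseSubgroup_le hirr hZ (hdom i) Q hQ).trans_lt (hl l hlp hlm i)
  have : g ∈ eraseSubgroup (h.decompositionGroup Q) i := htop ▸ Subgroup.mem_top g
  exact this

theorem IsInvariantDomain.smul_mem_of_decompositionGroup_eq_top (h : IsInvariantDomain G R j)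
    (Q : Ideal (coordAlg σ R)) :
    letI := h.action (ι := σ)
    h.decompositionGroup Q = ⊤ → ∀ g : σ → G, ∀ F ∈ Q, g • F ∈ Q := by
  let := h.action (ι := σ)
  intro hD g F hF
  have hg : g ∈ h.decompositionGroup Q := hD ▸ Subgroup.mem_top g
  exact smul_mem_of_mem_stabilizer hg hF

theorem IsInvariantDomain.exists_isPrime_liesOver [Finite σ] [Finite G]
    (h : IsInvariantDomain G R j)
    (p : Ideal (MvPolynomial σ ℂ)) [p.IsPrime] :
    letI := h.algebra σ
    ∃ Q : Ideal (coordAlg σ R), Q.IsPrime ∧ Q.LiesOver p := by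
  let := h.algebra σ
  let := h.action (ι := σ)
  have := h.isInvariant (ι := σ)
  have : Algebra.IsIntegral (MvPolynomial σ ℂ) (coordAlg σ R) :=
    Algebra.IsInvariant.isIntegral _ _ (σ → G)
  have hinj : Function.Injective (algebraMap (MvPolynomial σ ℂ) (coordAlg σ R)) := by
    rw [injective_iff_map_eq_zero]
    intro P hP
    refine MvPolynomial.funext fun z => ?_
    have hx : (fun k => j ((h.surjective (z k)).choose)) = z :=
      funext fun k => (h.surjective (z k)).choose_spec
    have := h.algebraMap_apply P fun k => (h.surjective (z k)).choose
    rw [hP, hx] at this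
    simpa [coe_aeval_eq_eval] using this.symm
  have := h.isDomain_coordAlg (ι := σ)
  obtain ⟨Q, hQ, hover⟩ := Ideal.exists_ideal_over_prime_of_isIntegral_of_isDomain
    (S := coordAlg σ R) p (by
      rw [(RingHom.injective_iff_ker_eq_bot _).1 hinj]
      exact bot_le)
  exact ⟨Q, hQ, ⟨hover.symm⟩⟩

/-- If `G` is perfect and generated by elements of order dividing `m`, and all prime divisors of `m`
are larger than the degrees of the projections of the hypersurface `Z`, then the image of the
preimage of `Z` in `X ^ σ` under a function in `R`, applied to all coordinates, is irreducible. -/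
theorem IsInvariantDomain.isZariskiIrreducible_of_isHypersurface [Finite σ] [Finite G]
    (h : IsInvariantDomain G R j)
    (hσ : 3 ≤ Nat.card σ) {Z : Set (σ → ℂ)} (hZ : IsHypersurface Z)
    (hirr : IsZariskiIrreducible Z) (hdom : ∀ i, IsZariskiDense (proj i '' Z)) {m : ℕ}
    (hperf : commutator G = ⊤) (hgen : Subgroup.closure {u : G | u ^ m = 1} = ⊤)
    (hl : ∀ l : ℕ, l.Prime → l ∣ m → ∀ i, projDegree Z hirr i < l) {y : X → ℂ} (hy : y ∈ R) :
    IsZariskiIrreducible {w | ∃ x : σ → X, (fun k => j (x k)) ∈ Z ∧ w = fun k => y (x k)} := by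
  have := hirr.isPrime
  have hZ' : ∃ f ∈ vanishingIdeal ℂ Z, f ≠ 0 := by
    obtain ⟨f, hf, -, rfl⟩ := hZ
    refine ⟨f, fun z hz => ?_, hf⟩
    simpa [zeroLocus_span] using hz
  obtain ⟨Q, hQ, hover⟩ := h.exists_isPrime_liesOver (vanishingIdeal ℂ Z)
  exact h.isZariskiIrreducible hirr Q hover (h.smul_mem_of_decompositionGroup_eq_top Q
    (h.decompositionGroup_eq_top hσ hZ' hirr hdom hperf hgen hl Q hover)) hy

end

end

/-! ### The modular function `j` -/

section

open UpperHalfPlane ModularForm ModularFormClass MatrixGroups EisensteinSeries Filter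
  SlashInvariantForm
open scoped Topology Manifold

/-- Klein's modular function `j = E₄³ / Δ` on the upper half plane. -/
def kleinJ (τ : ℍ) : ℂ := E₄ τ ^ 3 / discriminant τ

theorem E4_smul (γ : SL(2, ℤ)) (τ : ℍ) : E₄ (γ • τ) = denom γ τ ^ 4 * E₄ τ :=
  slash_action_eqn'' E₄ (γ := (γ : GL (Fin 2) ℝ)) (MonoidHom.mem_range.2 ⟨γ, rfl⟩) τ

theorem discriminant_smul (γ : SL(2, ℤ)) (τ : ℍ) :
    discriminant (γ • τ) = denom γ τ ^ 12 * discriminant τ :=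
  slash_action_eqn'' CuspForm.discriminant (γ := (γ : GL (Fin 2) ℝ))
    (MonoidHom.mem_range.2 ⟨γ, rfl⟩) τ

theorem kleinJ_smul (γ : SL(2, ℤ)) (τ : ℍ) : kleinJ (γ • τ) = kleinJ τ := by
  have h := denom_ne_zero (γ : GL (Fin 2) ℝ) τ
  have h' := discriminant_ne_zero τ
  rw [kleinJ, kleinJ, E4_smul, discriminant_smul]
  field_simp

theorem mdifferentiable_discriminant : MDiff discriminant := CuspForm.discriminant.holo'

theorem mdifferentiable_kleinJ : MDiff kleinJ :=
  (E₄.holo'.pow 3).div mdifferentiable_discriminant discriminant_ne_zero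

theorem mdifferentiable_comp_smul {f : ℍ → ℂ} (hf : MDiff f) (γ : SL(2, ℤ)) :
    MDiff (fun τ : ℍ => f (γ • τ)) :=
  hf.comp (mdifferentiable_smul (g := (γ : GL (Fin 2) ℝ)) (by simp))

/-- `j` has at most a simple pole at infinity. -/
theorem isBoundedAtImInfty_kleinJ_mul :
    IsBoundedAtImInfty (fun τ => kleinJ τ * discriminant τ) := by
  have h : IsBoundedAtImInfty (⇑E₄ ^ 3) := by
    simp only [pow_succ, pow_zero, one_mul]
    have h := bdd_at_infty E₄
    exact (h.mul h).mul h
  convert! h using 2 with τ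
  simp [kleinJ, discriminant_ne_zero]

/-- A function on the upper half plane with the transformation law of a modular form of weight `k`
and level one, holomorphic also at infinity, is a modular form. -/
def modularFormOfLevelOne {k : ℤ} (F : ℍ → ℂ) (hF : MDiff F)
    (hinv : ∀ (γ : SL(2, ℤ)) τ, F (γ • τ) = denom γ τ ^ k * F τ) (hb : IsBoundedAtImInfty F) :
    ModularForm 𝒮ℒ k :=
  have hs : ∀ γ : SL(2, ℤ), F ∣[k] γ = F := fun γ => by
    ext τ
    rw [SL_slash_apply, hinv, zpow_neg, mul_comm, ← mul_assoc, inv_mul_cancel₀, one_mul]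
    exact zpow_ne_zero _ (denom_ne_zero _ _)
  { toFun := F
    slash_action_eq' := fun _ ⟨γ, hγ⟩ => hγ ▸ hs γ
    holo' := hF
    bdd_at_cusps' := fun {c} hc => by
      rw [Subgroup.IsArithmetic.isCusp_iff_isCusp_SL2Z] at hc
      rw [OnePoint.isBoundedAt_iff_forall_SL2Z hc]
      intro γ _
      rw [hs γ]
      exact hb }

theorem exists_const_of_invariant {f : ℍ → ℂ} (hf : MDiff f)
    (hinv : ∀ (γ : SL(2, ℤ)) τ, f (γ • τ) = f τ) (hb : IsBoundedAtImInfty f) :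
    ∃ c, ∀ τ, f τ = c := by
  obtain ⟨c, hc⟩ := levelOne_weight_zero_const
    (modularFormOfLevelOne (k := 0) f hf (by simpa using hinv) hb)
  exact ⟨c, fun τ => congrFun hc τ⟩

/-- A holomorphic function invariant under `SL(2, ℤ)` with at most a pole at infinity is a
polynomial in `j`: subtracting a multiple of a power of `j` lowers the order of the pole. -/
theorem exists_eval_kleinJ (N : ℕ) : ∀ f : ℍ → ℂ, MDiff f →
    (∀ (γ : SL(2, ℤ)) τ, f (γ • τ) = f τ) →
    IsBoundedAtImInfty (fun τ => f τ * discriminant τ ^ N) →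
    ∃ P : Polynomial ℂ, ∀ τ, f τ = P.eval (kleinJ τ) := by
  induction N with
  | zero =>
    intro f hf hinv hb
    obtain ⟨c, hc⟩ := exists_const_of_invariant hf hinv (by simpa using hb)
    exact ⟨Polynomial.C c, by simpa using hc⟩
  | succ N ih =>
    intro f hf hinv hb
    let g : ModularForm 𝒮ℒ ((12 * (N + 1) : ℕ) : ℤ) := modularFormOfLevelOne _
      (hf.mul (mdifferentiable_discriminant.pow (N + 1))) (fun γ τ => by
        simp only [Pi.mul_apply, Pi.pow_apply, hinv, discriminant_smul, zpow_natCast]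
        ring) hb
    let e : ModularForm 𝒮ℒ ((12 * (N + 1) : ℕ) : ℤ) :=
      ModularForm.mcast (by push_cast; ring) (E₄.pow (3 * (N + 1)))
    have he : (qExpansion 1 e).coeff 0 = 1 := by
      simp only [e, coe_mcast, ModularForm.qExpansion_pow one_pos one_mem_strictPeriods_SL,
        PowerSeries.coeff_zero_eq_constantCoeff, map_pow]
      rw [← PowerSeries.coeff_zero_eq_constantCoeff_apply, E_qExpansion_coeff_zero _ ⟨2, rfl⟩,
        one_pow]
    obtain ⟨s, hs⟩ := sub_smul_isCuspForm g e he
    set c := (qExpansion 1 g).coeff 0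
    have hs' : ∀ τ, s τ = (f τ - c * kleinJ τ ^ (N + 1)) * discriminant τ ^ (N + 1) := by
      intro τ
      have h1 : s τ = (g - c • e) τ := DFunLike.congr_fun hs τ
      have h2 : g τ = f τ * discriminant τ ^ (N + 1) := rfl
      have h3 : e τ = E₄ τ ^ (3 * (N + 1)) := by
        simp only [e, coe_mcast, ModularForm.coe_pow, Pi.pow_apply]
      have h4 : (g - c • e) τ = g τ - c * e τ := rfl
      have h5 := discriminant_ne_zero τ
      rw [h1, h4, h2, h3, kleinJ, div_pow, pow_mul]
      field_simp
    obtain ⟨P, hP⟩ := ih (fun τ => f τ - c * kleinJ τ ^ (N + 1))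
      (hf.sub ((mdifferentiable_const (c := c)).mul (mdifferentiable_kleinJ.pow (N + 1))))
      (fun γ τ => by simp only [hinv, kleinJ_smul]) (by
        have h := CuspForm.exp_decay_isBigO_discriminant s
        have h' := (Asymptotics.div_isBoundedUnder_of_isBigO h).isBigO_one ℝ
        refine h'.congr_left fun τ => ?_
        have h5 := discriminant_ne_zero τ
        rw [hs', pow_succ (discriminant τ), ← mul_assoc, mul_div_cancel_right₀ _ h5])
    refine ⟨P + Polynomial.C c * Polynomial.X ^ (N + 1), fun τ => ?_⟩
    simp [← hP]

/-- `j` is surjective: if it omits `c`, then `1 / (j - c)` is holomorphic, invariant, and vanishes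
at infinity, hence is zero. -/
theorem kleinJ_surjective : Function.Surjective kleinJ := by
  intro c
  by_contra! hc
  have hD : Tendsto discriminant atImInfty (𝓝 0) := discriminant_isZeroAtImInfty
  have hE : Tendsto (⇑E₄) atImInfty (𝓝 1) := by
    have h1 : valueAtInfty E₄ = 1 := by
      rw [← qExpansion_coeff_zero one_pos
        (ModularFormClass.analyticAt_cuspFunction_zero E₄ one_pos one_mem_strictPeriods_SL)
        (SlashInvariantFormClass.periodic_comp_ofComplex E₄ one_mem_strictPeriods_SL)]
      exact E_qExpansion_coeff_zero _ ⟨2, rfl⟩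
    have h2 := exp_decay_sub_atImInfty one_pos
      (SlashInvariantFormClass.periodic_comp_ofComplex E₄ one_mem_strictPeriods_SL) E₄.holo'
      (bdd_at_infty E₄)
    simp only [h1, div_one] at h2
    simpa using ((h2.trans exp_isBigO_discriminant).trans_tendsto hD).add_const 1
  have hne : ∀ τ, E₄ τ ^ 3 - c * discriminant τ ≠ 0 := fun τ h => hc τ (by
    rw [kleinJ, div_eq_iff (discriminant_ne_zero τ)]
    linear_combination h)
  have hlim : Tendsto (fun τ => discriminant τ / (E₄ τ ^ 3 - c * discriminant τ)) atImInfty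
      (𝓝 0) := by
    have := hD.div ((hE.pow 3).sub (hD.const_mul c)) (by simp)
    simpa [Pi.div_def] using this
  obtain ⟨d, hd⟩ := exists_const_of_invariant
    (f := fun τ => discriminant τ / (E₄ τ ^ 3 - c * discriminant τ))
    (mdifferentiable_discriminant.div ((E₄.holo'.pow 3).sub
      ((mdifferentiable_const (c := c)).mul mdifferentiable_discriminant)) hne)
    (fun γ τ => by
      have h := denom_ne_zero (γ : GL (Fin 2) ℝ) τ
      have h' := hne τ
      have h2 : (denom γ τ ^ 4 * E₄ τ) ^ 3 - c * (denom γ τ ^ 12 * discriminant τ) =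
        denom γ τ ^ 12 * (E₄ τ ^ 3 - c * discriminant τ) := by ring
      rw [E4_smul, discriminant_smul, h2, mul_div_mul_left _ _ (pow_ne_zero _ h)])
    (IsZeroAtImInfty.isBoundedAtImInfty hlim)
  simp only [hd] at hlim
  have h0 := tendsto_nhds_unique hlim tendsto_const_nhds
  have := hd I
  rw [← h0, div_eq_zero_iff] at this
  exact this.elim (discriminant_ne_zero I) (hne I)

end

/-! ### Modular functions of level `m` -/

section

open UpperHalfPlane ModularForm ModularFormClass MatrixGroups EisensteinSeries Filter
  SlashInvariantForm
open scoped Topology Manifold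

/-- The action of the quotient of a group by a normal subgroup `N` on the space of `N`-orbits. -/
instance quotientMulAction {Γ Y : Type*} [Group Γ] [MulAction Γ Y] (N : Subgroup Γ) [N.Normal] :
    MulAction (Γ ⧸ N) (MulAction.orbitRel.Quotient N Y) where
  smul := Quotient.map₂ (fun g y => g • y) (by
    rintro g g' hg y y' ⟨k, rfl⟩
    have hg' : g⁻¹ * g' ∈ N := QuotientGroup.leftRel_apply.1 hg
    refine ⟨⟨g * (k * (g⁻¹ * g')⁻¹) * g⁻¹,
      ‹N.Normal›.conj_mem _ (N.mul_mem k.2 (N.inv_mem hg')) g⟩, ?_⟩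
    change (g * (k * (g⁻¹ * g')⁻¹) * g⁻¹) • g' • y' = g • (k : Γ) • y'
    simp only [smul_smul]
    congr 1
    group)
  one_smul := by
    rintro ⟨y⟩
    exact congrArg (Quotient.mk _) (one_smul Γ y)
  mul_smul := by
    rintro ⟨g⟩ ⟨g'⟩ ⟨y⟩
    exact congrArg (Quotient.mk _) (mul_smul g g' y)

/-- The modular curve `Γ(m) \ ℍ`, as a set. -/
abbrev ModularCurve (m : ℕ) : Type := MulAction.orbitRel.Quotient (CongruenceSubgroup.Gamma m) ℍ

instance (m : ℕ) : (CongruenceSubgroup.Gamma m).Normal := CongruenceSubgroup.Gamma_normal m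

/-- The class of a point of the upper half plane in `Γ(m) \ ℍ`. -/
def ModularCurve.mk (m : ℕ) (τ : ℍ) : ModularCurve m := Quotient.mk _ τ

theorem ModularCurve.mk_surjective (m : ℕ) : Function.Surjective (ModularCurve.mk m) :=
  Quotient.mk_surjective

/-- The function on `Γ(m) \ ℍ` defined by a `Γ(m)`-invariant function on the upper half plane. -/
def ModularCurve.lift {m : ℕ} (f : ℍ → ℂ)
    (hf : ∀ γ ∈ CongruenceSubgroup.Gamma m, ∀ τ, f (γ • τ) = f τ) : ModularCurve m → ℂ :=
  Quotient.lift f (by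
    rintro _ τ ⟨γ, rfl⟩
    exact hf γ γ.2 τ)

theorem isBoundedAtImInfty_mul_discriminant_pow {f : ℍ → ℂ} {N N' : ℕ} (h : N ≤ N')
    (hf : IsBoundedAtImInfty (fun τ => f τ * discriminant τ ^ N)) :
    IsBoundedAtImInfty (fun τ => f τ * discriminant τ ^ N') := by
  have hD : IsBoundedAtImInfty (discriminant ^ (N' - N)) :=
    Subalgebra.pow_mem (boundedFilterSubalgebra ℂ atImInfty)
      (IsZeroAtImInfty.isBoundedAtImInfty discriminant_isZeroAtImInfty) _
  convert! hf.mul hD using 2 with τ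
  simp [mul_assoc, ← pow_add, Nat.add_sub_cancel' h]

/-- The algebra of the functions on `Γ(m) \ ℍ` that are holomorphic on `ℍ` and meromorphic at the
cusps: after any substitution `τ ↦ γ τ` with `γ ∈ SL(2, ℤ)`, some power of `Δ` bounds the growth
at infinity. This is the coordinate ring of the affine modular curve of level `m`. -/
def modularAlg (m : ℕ) : Subalgebra ℂ (ModularCurve m → ℂ) where
  carrier := {f | MDiff (fun τ => f (.mk m τ)) ∧ ∀ γ : SL(2, ℤ), ∃ N : ℕ,
    IsBoundedAtImInfty (fun τ => f (.mk m (γ • τ)) * discriminant τ ^ N)}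
  mul_mem' := by
    rintro f g ⟨hf, hf'⟩ ⟨hg, hg'⟩
    refine ⟨hf.mul hg, fun γ => ?_⟩
    obtain ⟨N, hN⟩ := hf' γ
    obtain ⟨N', hN'⟩ := hg' γ
    refine ⟨N + N', ?_⟩
    convert! hN.mul hN' using 2 with τ
    simp only [Pi.mul_apply, pow_add]
    ring
  add_mem' := by
    rintro f g ⟨hf, hf'⟩ ⟨hg, hg'⟩
    refine ⟨hf.add hg, fun γ => ?_⟩
    obtain ⟨N, hN⟩ := hf' γ
    obtain ⟨N', hN'⟩ := hg' γ
    refine ⟨max N N', ?_⟩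
    convert! (isBoundedAtImInfty_mul_discriminant_pow (le_max_left N N') hN).add
      (isBoundedAtImInfty_mul_discriminant_pow (le_max_right N N') hN') using 2 with τ
    simp only [Pi.add_apply, add_mul]
  algebraMap_mem' c := ⟨mdifferentiable_const, fun γ => ⟨0, by
    simpa using! const_boundedAtFilter atImInfty c⟩⟩

/-- The modular function `j` on `Γ(m) \ ℍ`. -/
def levelJ (m : ℕ) : ModularCurve m → ℂ := ModularCurve.lift kleinJ fun γ _ => kleinJ_smul γ

theorem levelJ_mk (m : ℕ) (τ : ℍ) : levelJ m (.mk m τ) = kleinJ τ := rfl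

theorem isInvariantDomain_modularAlg (m : ℕ) :
    IsInvariantDomain (SL(2, ℤ) ⧸ CongruenceSubgroup.Gamma m) (modularAlg m) (levelJ m) where
  comp_smul_mem := by
    rintro ⟨g⟩ f ⟨hf, hf'⟩
    refine ⟨mdifferentiable_comp_smul hf g, fun γ => ?_⟩
    obtain ⟨N, hN⟩ := hf' (g * γ)
    simp only [mul_smul] at hN
    exact ⟨N, hN⟩
  eq_zero_or_eq_zero := by
    rintro f ⟨hf, -⟩ g ⟨hg, -⟩ hfg
    have h := (mul_eq_zero_iff hf hg).1 (funext fun τ => congrFun hfg (.mk m τ))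
    refine h.imp (fun h => ?_) (fun h => ?_) <;>
    · funext x
      obtain ⟨τ, rfl⟩ := ModularCurve.mk_surjective m x
      exact congrFun h τ
  mem := ⟨mdifferentiable_kleinJ, fun γ => ⟨1, by
    simpa only [levelJ_mk, kleinJ_smul, pow_one] using isBoundedAtImInfty_kleinJ_mul⟩⟩
  apply_smul := by
    rintro ⟨g⟩ x
    obtain ⟨τ, rfl⟩ := ModularCurve.mk_surjective m x
    exact kleinJ_smul g τ
  exists_eval := by
    rintro f ⟨hf, hf'⟩ hinv
    obtain ⟨N, hN⟩ := hf' 1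
    obtain ⟨P, hP⟩ := exists_eval_kleinJ N _ hf (fun γ τ => hinv (γ : SL(2, ℤ)) (.mk m τ))
      (by simpa only [one_smul] using hN)
    refine ⟨P, fun x => ?_⟩
    obtain ⟨τ, rfl⟩ := ModularCurve.mk_surjective m x
    exact hP τ
  surjective := fun c => (kleinJ_surjective c).imp' (ModularCurve.mk m) fun _ h => h

/-- The matrix with diagonal entries `m` and `1`, which acts on `ℍ` as multiplication by `m`. -/
def scaleMatrix (m : ℕ) [NeZero m] : GL (Fin 2) ℝ :=
  Matrix.GeneralLinearGroup.mkOfDetNeZero !![(m : ℝ), 0; 0, 1]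
    (by simpa using NeZero.ne m)

theorem coe_scaleMatrix_smul (m : ℕ) [NeZero m] (τ : ℍ) :
    ((scaleMatrix m • τ : ℍ) : ℂ) = m * τ := by
  rw [coe_smul_of_det_pos (by simp [scaleMatrix, Nat.pos_of_neZero])]
  simp [scaleMatrix, num, denom]

/-- The growth of `j` at infinity under a substitution by an upper triangular matrix: the imaginary
part grows at most by the factor `det U`, as the lower right entry is at least `1`. -/
theorem isBoundedAtImInfty_kleinJ_smul {U : GL (Fin 2) ℝ} (h0 : U 1 0 = 0) (h1 : 1 ≤ |U 1 1|)
    {m : ℕ} (hdet : U.det.val = m) :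
    IsBoundedAtImInfty (fun τ => kleinJ (U • τ) * discriminant τ ^ m) := by
  have him : ∀ τ : ℍ, (U • τ).im ≤ m * τ.im := by
    intro τ
    have hd : Complex.normSq (denom U τ) = |U 1 1| ^ 2 := by
      simp [denom, h0, Complex.normSq_ofReal, sq]
    rw [im_smul_eq_div_normSq, hdet, hd, Nat.abs_cast]
    exact div_le_self (mul_nonneg (Nat.cast_nonneg _) τ.im_pos.le) (one_le_pow₀ h1)
  have hU := tendsto_smul_atImInfty h0
  have hD : (fun τ => discriminant τ ^ m) =O[atImInfty] fun τ => discriminant (U • τ) := by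
    have hexp := CuspFormClass.exp_decay_atImInfty (h := 1) CuspForm.discriminant one_pos
      one_mem_strictPeriods_SL
    refine (hexp.pow m).trans (.trans ?_ (exp_isBigO_discriminant.comp_tendsto hU))
    refine Asymptotics.IsBigO.of_norm_le fun τ => ?_
    rw [div_one, Function.comp_apply, ← Real.exp_nat_mul, Real.norm_of_nonneg (Real.exp_nonneg _)]
    refine Real.exp_le_exp.2 ?_
    have := mul_le_mul_of_nonneg_left (him τ) Real.two_pi_pos.le
    linarith
  exact ((Asymptotics.isBigO_refl (fun τ => kleinJ (U • τ)) atImInfty).mul hD).trans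
    (isBoundedAtImInfty_kleinJ_mul.comp_tendsto hU)

theorem scaleMatrix_apply (m : ℕ) [NeZero m] (i k : Fin 2) :
    scaleMatrix m i k = !![(m : ℝ), 0; 0, 1] i k := rfl

/-- A matrix in `SL(2, ℤ)` on the left makes `scaleMatrix m * γ` upper triangular. -/
theorem exists_mul_scaleMatrix_mul_apply_one_zero (m : ℕ) [NeZero m] (γ : SL(2, ℤ)) :
    ∃ (δ : SL(2, ℤ)) (e : ℤ), ((δ : GL (Fin 2) ℝ) * scaleMatrix m * γ) 1 0 = 0 ∧
      ((δ : GL (Fin 2) ℝ) * scaleMatrix m * γ) 1 1 = e := by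
  have hpos : 0 < Int.gcd (m * γ 0 0) (γ 1 0) := by
    rw [Int.gcd_pos_iff]
    by_contra! h
    have hdet := γ.det_coe
    rw [Matrix.det_fin_two, (mul_eq_zero.1 h.1).resolve_left (by simpa using NeZero.ne m), h.2]
      at hdet
    simp at hdet
  obtain ⟨g, p, q, -, hpq, hp, hq⟩ := Int.exists_gcd_one' hpos
  obtain ⟨δ, hδ0, hδ1⟩ := IsCoprime.exists_SL2_row
    (Int.isCoprime_iff_gcd_eq_one.2 hpq).symm.neg_left 1
  refine ⟨δ, -q * (m * γ 0 1) + p * γ 1 1, ?_, ?_⟩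
  · have h : (((-q) * (m * γ 0 0) + p * γ 1 0 : ℤ) : ℝ) = 0 := by
      rw [hp, hq]
      push_cast
      ring
    push_cast at h
    simp [Matrix.mul_apply, scaleMatrix_apply, hδ0, hδ1]
    linarith
  · simp [Matrix.mul_apply, scaleMatrix_apply, hδ0, hδ1]
    ring

theorem isBoundedAtImInfty_kleinJ_scale_smul (m : ℕ) [NeZero m] (γ : SL(2, ℤ)) :
    IsBoundedAtImInfty (fun τ => kleinJ (scaleMatrix m • γ • τ) * discriminant τ ^ m) := by
  obtain ⟨δ, e, h0, h1⟩ := exists_mul_scaleMatrix_mul_apply_one_zero m γ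
  set U := (δ : GL (Fin 2) ℝ) * scaleMatrix m * γ with hU
  have hdet : U.det.val = m := by
    simp [hU, scaleMatrix]
  have he : e ≠ 0 := by
    rintro rfl
    rw [Matrix.GeneralLinearGroup.val_det_apply, Matrix.det_fin_two, h0, h1] at hdet
    simp [eq_comm, NeZero.ne m] at hdet
  have h1' : 1 ≤ |U 1 1| := by
    rw [h1]
    exact_mod_cast Int.one_le_abs he
  have h (τ : ℍ) : kleinJ (scaleMatrix m • γ • τ) = kleinJ (U • τ) := by
    rw [hU, mul_smul, mul_smul, ← ModularGroup.sl_moeb, ← ModularGroup.sl_moeb, kleinJ_smul]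
  simpa only [h] using isBoundedAtImInfty_kleinJ_smul h0 h1' hdet

theorem kleinJ_scale_smul (m : ℕ) [NeZero m] {γ : SL(2, ℤ)} (hγ : γ ∈ CongruenceSubgroup.Gamma m)
    (τ : ℍ) : kleinJ (scaleMatrix m • γ • τ) = kleinJ (scaleMatrix m • τ) := by
  obtain ⟨c, hc⟩ := (ZMod.intCast_zmod_eq_zero_iff_dvd _ _).1
    (CongruenceSubgroup.Gamma_mem.1 hγ).2.2.1
  have hdet := γ.det_coe
  rw [Matrix.det_fin_two, hc] at hdet
  -- the conjugate of `γ` by `scaleMatrix m` is integral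
  obtain ⟨δ, h00, h01, h10, h11⟩ : ∃ δ : SL(2, ℤ),
      δ 0 0 = γ 0 0 ∧ δ 0 1 = m * γ 0 1 ∧ δ 1 0 = c ∧ δ 1 1 = γ 1 1 :=
    ⟨⟨!![γ 0 0, m * γ 0 1; c, γ 1 1], by
      rw [Matrix.det_fin_two_of]
      linear_combination hdet⟩, rfl, rfl, rfl, rfl⟩
  have hδ : (δ : GL (Fin 2) ℝ) * scaleMatrix m = scaleMatrix m * γ := by
    ext i k
    fin_cases i <;> fin_cases k <;>
      simp [Matrix.mul_apply, scaleMatrix_apply, h00, h01, h10, h11, hc, mul_comm]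
  rw [ModularGroup.sl_moeb, ← mul_smul, ← hδ, mul_smul, ← ModularGroup.sl_moeb, kleinJ_smul]

/-- The modular function `j(mτ)` on `Γ(m) \ ℍ`. -/
def levelScaleJ (m : ℕ) [NeZero m] : ModularCurve m → ℂ :=
  ModularCurve.lift (fun τ => kleinJ (scaleMatrix m • τ)) fun _ hγ => kleinJ_scale_smul m hγ

theorem levelScaleJ_mem (m : ℕ) [NeZero m] : levelScaleJ m ∈ modularAlg m :=
  ⟨mdifferentiable_kleinJ.comp
    (mdifferentiable_smul (by simp [scaleMatrix, Nat.pos_of_neZero])),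
    fun γ => ⟨m, isBoundedAtImInfty_kleinJ_scale_smul m γ⟩⟩

end

/-! ### The `j`-invariant of a lattice, and cyclic isogenies -/

section

open UpperHalfPlane ModularForm EisensteinSeries

theorem eq_of_mul_add_eq (τ : ℍ) {a b a' b' : ℤ} (h : (a * τ + b : ℂ) = a' * τ + b') :
    a = a' ∧ b = b' := by
  have him := congrArg Complex.im h
  simp [τ.im_ne_zero] at him
  subst him
  exact ⟨rfl, by simpa using h⟩

section

variable {L : PeriodPair} {α : ℂ} {τ : ℍ}

/-- The parametrization of a lattice `α (ℤ τ + ℤ)` by pairs of integers. -/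
def pairEquivLattice (hα : α ≠ 0)
    (h : ∀ z, z ∈ L.lattice ↔ ∃ a b : ℤ, z = α * (a * τ + b)) : (Fin 2 → ℤ) ≃ L.lattice :=
  Equiv.ofBijective (fun v => ⟨α * (v 0 * τ + v 1), (h _).2 ⟨_, _, rfl⟩⟩) (by
    constructor
    · intro v w hvw
      obtain ⟨h0, h1⟩ := eq_of_mul_add_eq τ (mul_left_cancel₀ hα (congrArg Subtype.val hvw))
      ext i
      fin_cases i
      exacts [h0, h1]
    · rintro ⟨z, hz⟩
      obtain ⟨a, b, rfl⟩ := (h z).1 hz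
      exact ⟨![a, b], by simp⟩)

/-- The Eisenstein series of the lattice `α (ℤ τ + ℤ)`, in terms of the normalized one. -/
theorem G_eq (hα : α ≠ 0) (h : ∀ z, z ∈ L.lattice ↔ ∃ a b : ℤ, z = α * (a * τ + b)) {k : ℕ}
    (hk : 3 ≤ k) : L.G k = (α ^ k)⁻¹ * (2 * riemannZeta k * E hk τ) := by
  have hE : E hk τ = (1 / 2 : ℂ) * eisensteinSeries (N := 1) 0 k τ := rfl
  rw [hE, PeriodPair.G, ← (pairEquivLattice hα h).tsum_eq]
  have := tsum_eisSummand_eq_riemannZeta_mul_eisensteinSeries hk τ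
  calc _ = ∑' v : Fin 2 → ℤ, (α ^ k)⁻¹ * eisSummand k v τ := by
        refine tsum_congr fun v => ?_
        simp [pairEquivLattice, eisSummand, mul_pow, mul_comm]
    _ = _ := by
        rw [tsum_mul_left, this]
        ring

/-- The `j`-invariant of the lattice `α (ℤ τ + ℤ)`. -/
theorem jInv_eq_kleinJ (hα : α ≠ 0)
    (h : ∀ z, z ∈ L.lattice ↔ ∃ a b : ℤ, z = α * (a * τ + b)) : jInv L = kleinJ τ := by
  have hζ4 : riemannZeta (4 : ℕ) = Real.pi ^ 4 / 90 := by exact_mod_cast riemannZeta_four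
  have hζ6 : riemannZeta (6 : ℕ) = Real.pi ^ 6 / 945 := by
    have h := riemannZeta_two_mul_nat (k := 3) (by norm_num)
    norm_num [show bernoulli 6 = 1 / 42 by decide +kernel, Nat.factorial] at h
    push_cast
    rw [h]
    ring
  have hπ : (Real.pi : ℂ) ≠ 0 := by exact_mod_cast Real.pi_ne_zero
  have h2 : L.g₂ = 4 * Real.pi ^ 4 / 3 / α ^ 4 * E₄ τ := by
    rw [PeriodPair.g₂, G_eq hα h (by norm_num), hζ4]
    field_simp
    ring
  have h3 : L.g₃ = 8 * Real.pi ^ 6 / 27 / α ^ 6 * E₆ τ := by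
    rw [PeriodPair.g₃, G_eq hα h (by norm_num), hζ6]
    field_simp
    ring
  have hD : discriminant τ ≠ 0 := discriminant_ne_zero τ
  have hD' := discriminant_eq_E₄_cube_sub_E₆_sq τ
  have hd : L.g₂ ^ 3 - 27 * L.g₃ ^ 2 =
      1728 * (4 * Real.pi ^ 4 / 3 / α ^ 4) ^ 3 * discriminant τ := by
    rw [h2, h3, hD']
    field_simp
    ring
  rw [jInv, kleinJ, hd, h2, mul_pow]
  field_simp

end

/-- A cyclic isogeny in terms of a complex number `w` representing a generator of its kernel. -/
theorem cyclicIsogeny_iff {m : ℕ} {L L' : PeriodPair} :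
    CyclicIsogeny m L L' ↔ ∃ α : ℂ, α ≠ 0 ∧ (∀ z ∈ L.lattice, α * z ∈ L'.lattice) ∧
      ∃ w : ℂ, α * w ∈ L'.lattice ∧
        (∀ x, α * x ∈ L'.lattice → ∃ k : ℤ, x - k * w ∈ L.lattice) ∧
        ∀ k : ℤ, k * w ∈ L.lattice ↔ (m : ℤ) ∣ k := by
  refine exists_congr fun α => and_congr_right fun hα => ?_
  constructor
  · rintro ⟨h, ⟨e⟩⟩
    refine ⟨h, ?_⟩
    obtain ⟨⟨κ, hκ⟩, he⟩ := e.surjective 1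
    obtain ⟨w, rfl⟩ := Submodule.Quotient.mk_surjective _ κ
    refine ⟨w, (Submodule.Quotient.mk_eq_zero _).1 hκ, fun x hx => ?_, fun k => ?_⟩
    · obtain ⟨k, hk⟩ := ZMod.intCast_surjective
        (e ⟨Submodule.Quotient.mk x, (Submodule.Quotient.mk_eq_zero _).2 hx⟩)
      refine ⟨k, ?_⟩
      rw [← Submodule.Quotient.mk_eq_zero, Submodule.Quotient.mk_sub, sub_eq_zero, ← zsmul_eq_mul,
        Submodule.Quotient.mk_smul]
      have : (⟨Submodule.Quotient.mk x, (Submodule.Quotient.mk_eq_zero _).2 hx⟩ :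
          LinearMap.ker (Submodule.mapQ L.lattice L'.lattice (LinearMap.mulLeft ℤ α) h)) =
          k • ⟨Submodule.Quotient.mk w, hκ⟩ := by
        apply e.injective
        rw [← hk, map_zsmul, he, zsmul_one]
      exact congrArg Subtype.val this
    · rw [← ZMod.intCast_zmod_eq_zero_iff_dvd, ← zsmul_one (R := ZMod m), ← he, ← map_zsmul,
        map_eq_zero_iff e e.injective, ← Submodule.Quotient.mk_eq_zero, ← zsmul_eq_mul,
        Submodule.Quotient.mk_smul, Subtype.ext_iff]
      rfl
  · rintro ⟨h, w, hw, hgen, hk⟩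
    refine ⟨h, ⟨?_⟩⟩
    let κ : LinearMap.ker (Submodule.mapQ L.lattice L'.lattice (LinearMap.mulLeft ℤ α) h) :=
      ⟨Submodule.Quotient.mk w, (Submodule.Quotient.mk_eq_zero _).2 hw⟩
    have hκ : ∀ k : ℤ, k • κ = 0 ↔ (m : ℤ) ∣ k := by
      intro k
      rw [← hk, ← Submodule.Quotient.mk_eq_zero, ← zsmul_eq_mul, Submodule.Quotient.mk_smul,
        Subtype.ext_iff]
      rfl
    refine (AddEquiv.ofBijective (ZMod.lift m ⟨zmultiplesHom _ κ, ?_⟩) ⟨?_, ?_⟩).symm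
    · simpa using (hκ m).2 dvd_rfl
    · rw [ZMod.lift_injective]
      intro k hk
      exact (ZMod.intCast_zmod_eq_zero_iff_dvd _ _).2 ((hκ k).1 hk)
    · rintro ⟨x, hx⟩
      obtain ⟨x, rfl⟩ := Submodule.Quotient.mk_surjective _ x
      obtain ⟨k, hk⟩ := hgen x ((Submodule.Quotient.mk_eq_zero _).1 hx)
      refine ⟨k, ?_⟩
      rw [ZMod.lift_coe]
      refine Subtype.ext (Eq.symm ?_)
      rw [← Submodule.Quotient.mk_eq_zero, Submodule.Quotient.mk_sub, sub_eq_zero, ← zsmul_eq_mul,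
        Submodule.Quotient.mk_smul] at hk
      exact hk

end

/-! ### The Hecke correspondence in terms of modular functions -/

section

open UpperHalfPlane ModularForm EisensteinSeries

/-- A lattice is not contained in a real line. -/
theorem not_forall_mem_lattice_real_mul (L : PeriodPair) (w : ℂ) :
    ¬ ∀ z ∈ L.lattice, ∃ r : ℝ, z = r * w := by
  intro h
  obtain ⟨r, hr⟩ := h _ L.ω₁_mem_lattice
  obtain ⟨s, hs⟩ := h _ L.ω₂_mem_lattice
  have h0 := LinearIndependent.pair_iff.1 L.indep s (-r) (by
    simp only [hr, hs, Complex.real_smul]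
    push_cast
    ring)
  have h1 := LinearIndependent.pair_iff.1 L.indep 1 0 (by
    simp [hr, neg_eq_zero.1 h0.2])
  exact one_ne_zero h1.1

/-- Adapted bases for a cyclic isogeny: a generator of the kernel can be taken to be a primitive
vector of the larger lattice `α⁻¹ L'`, and a complementary basis vector can be moved into `L` by
subtracting a multiple of that generator. -/
theorem CyclicIsogeny.exists_basis {m : ℕ} (hm : 1 < m) {L L' : PeriodPair}
    (h : CyclicIsogeny m L L') : ∃ α w₁ w₂ : ℂ, α ≠ 0 ∧ w₁ ≠ 0 ∧ 0 < (w₂ / w₁).im ∧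
      (∀ z, z ∈ L.lattice ↔ ∃ a b : ℤ, z = a * w₂ + b * (m * w₁)) ∧
      ∀ z, z ∈ L'.lattice ↔ ∃ a b : ℤ, z = α * (a * w₂ + b * w₁) := by
  obtain ⟨α, hα, hL, w, hw, hgen, hk⟩ := cyclicIsogeny_iff.1 h
  suffices hmain : ∃ w₁ w₂ : ℂ,
      (∀ z, z ∈ L.lattice ↔ ∃ a b : ℤ, z = a * w₂ + b * (m * w₁)) ∧
      ∀ z, z ∈ L'.lattice ↔ ∃ a b : ℤ, z = α * (a * w₂ + b * w₁) by
    obtain ⟨w₁, w₂, h1, h2⟩ := hmain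
    have hw₁ : w₁ ≠ 0 := by
      rintro rfl
      refine not_forall_mem_lattice_real_mul L w₂ fun z hz => ?_
      obtain ⟨a, b, rfl⟩ := (h1 z).1 hz
      exact ⟨a, by simp⟩
    have him : (w₂ / w₁).im ≠ 0 := by
      intro h0
      obtain ⟨r, hr⟩ : ∃ r : ℝ, w₂ = r * w₁ := ⟨(w₂ / w₁).re, by
        rw [show (((w₂ / w₁).re : ℝ) : ℂ) = w₂ / w₁ from Complex.ext rfl h0.symm]
        field_simp⟩
      refine not_forall_mem_lattice_real_mul L w₁ fun z hz => ?_
      obtain ⟨a, b, rfl⟩ := (h1 z).1 hz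
      exact ⟨a * r + b * m, by rw [hr]; push_cast; ring⟩
    rcases him.lt_or_gt with hneg | hpos
    · refine ⟨α, w₁, -w₂, hα, hw₁, by simpa [neg_div] using hneg, fun z => ?_, fun z => ?_⟩
      · rw [h1, ← (Equiv.neg ℤ).exists_congr_right]
        simp
      · rw [h2, ← (Equiv.neg ℤ).exists_congr_right]
        simp
    · exact ⟨α, w₁, w₂, hα, hw₁, hpos, h1, h2⟩
  -- a basis of `α⁻¹ L'`, in which `w` has coordinates `p * g`, `q * g`
  obtain ⟨u, hu⟩ : ∃ u, α * u = L'.ω₁ := ⟨L'.ω₁ / α, mul_div_cancel₀ _ hα⟩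
  obtain ⟨v, hv⟩ : ∃ v, α * v = L'.ω₂ := ⟨L'.ω₂ / α, mul_div_cancel₀ _ hα⟩
  have hM : ∀ z, α * z ∈ L'.lattice ↔ ∃ a b : ℤ, z = a * u + b * v := by
    intro z
    rw [PeriodPair.mem_lattice]
    refine exists_congr fun a => exists_congr fun b => ?_
    rw [← hu, ← hv, eq_comm, ← mul_right_inj' (b := z) hα]
    ring_nf
  obtain ⟨p₀, q₀, hpq₀⟩ := (hM w).1 hw
  have hpos : 0 < Int.gcd p₀ q₀ := by
    rw [Int.gcd_pos_iff]
    by_contra! h0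
    have h1 : w = 0 := by simp [hpq₀, h0.1, h0.2]
    have h2 := (hk 1).1 (by simp [h1])
    exact hm.ne' (by exact_mod_cast Int.eq_one_of_dvd_one (by positivity) h2)
  obtain ⟨g, p, q, -, hpq, rfl, rfl⟩ := Int.exists_gcd_one' hpos
  obtain ⟨r, s, hrs⟩ := Int.isCoprime_iff_gcd_eq_one.2 hpq
  set w₁ : ℂ := p * u + q * v with hw₁
  have hwg : w = g * w₁ := by
    rw [hpq₀, hw₁]
    push_cast
    ring
  have hmul : ∀ x, α * x ∈ L'.lattice → (m : ℂ) * x ∈ L.lattice := by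
    intro x hx
    obtain ⟨k, hx⟩ := hgen x hx
    have h1 := L.lattice.smul_mem (m : ℤ) hx
    have h2 := (hk (m * k)).2 (dvd_mul_right _ _)
    convert! L.lattice.add_mem h1 h2 using 1
    push_cast [zsmul_eq_mul]
    ring
  have hw₁M : α * w₁ ∈ L'.lattice := (hM _).2 ⟨p, q, rfl⟩
  have hdvd : ∀ k : ℤ, k * w₁ ∈ L.lattice → (m : ℤ) ∣ k := by
    intro k hkw
    refine (hk k).1 ?_
    convert! L.lattice.smul_mem (g : ℤ) hkw using 1
    rw [hwg]
    push_cast [zsmul_eq_mul]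
    ring
  obtain ⟨k, hkv⟩ := hgen (r * v - s * u) ((hM _).2 ⟨-s, r, by push_cast; ring⟩)
  set w₂ : ℂ := r * v - s * u - k * w with hw₂
  have hrs' : (r * p + s * q : ℂ) = 1 := by exact_mod_cast hrs
  have hM' : ∀ z, α * z ∈ L'.lattice ↔ ∃ a b : ℤ, z = a * w₂ + b * w₁ := by
    intro z
    rw [hM]
    constructor
    · rintro ⟨a, b, rfl⟩
      refine ⟨p * b - q * a, r * a + s * b + (p * b - q * a) * k * g, ?_⟩
      rw [hw₂, hwg, hw₁]
      push_cast
      linear_combination (-a * u - b * v) * hrs'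
    · rintro ⟨a, b, rfl⟩
      refine ⟨-a * s - a * k * g * p + b * p, a * r - a * k * g * q + b * q, ?_⟩
      rw [hw₂, hwg, hw₁]
      push_cast
      ring
  refine ⟨w₁, w₂, fun z => ⟨fun hz => ?_, ?_⟩, fun z => ?_⟩
  · obtain ⟨a, b, rfl⟩ := (hM' z).1 (hL z hz)
    have h1 : (b : ℂ) * w₁ ∈ L.lattice := by
      convert! L.lattice.sub_mem hz (L.lattice.smul_mem a hkv) using 1
      rw [zsmul_eq_mul]
      ring
    obtain ⟨c, rfl⟩ := hdvd b h1
    exact ⟨a, c, by push_cast; ring⟩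
  · rintro ⟨a, b, rfl⟩
    convert! L.lattice.add_mem (L.lattice.smul_mem a hkv)
      (L.lattice.smul_mem b (hmul w₁ hw₁M)) using 1
    simp only [zsmul_eq_mul]
  · rw [← mul_div_cancel₀ z hα, hM']
    simp only [mul_right_inj' hα]

/-- The period pair `(τ, 1)`. -/
def upperPair (τ : ℍ) : PeriodPair where
  ω₁ := τ
  ω₂ := 1
  indep := by
    rw [LinearIndependent.pair_iff]
    intro s t h
    have him := congrArg Complex.im h
    simp [τ.im_ne_zero] at him
    subst him
    simpa using h

theorem mem_upperPair_lattice {τ : ℍ} {z : ℂ} :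
    z ∈ (upperPair τ).lattice ↔ ∃ a b : ℤ, z = a * τ + b := by
  rw [PeriodPair.mem_lattice]
  simp [upperPair, eq_comm]

theorem jInv_upperPair (τ : ℍ) : jInv (upperPair τ) = kleinJ τ :=
  jInv_eq_kleinJ one_ne_zero fun z => by simp [mem_upperPair_lattice]

theorem cyclicIsogeny_upperPair (m : ℕ) [NeZero m] (τ : ℍ) :
    CyclicIsogeny m (upperPair τ) (upperPair (scaleMatrix m • τ)) := by
  have hm : (m : ℂ) ≠ 0 := NeZero.ne _
  rw [cyclicIsogeny_iff]
  refine ⟨m, hm, ?_, 1 / m, ?_, ?_, ?_⟩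
  · intro z hz
    obtain ⟨a, b, rfl⟩ := mem_upperPair_lattice.1 hz
    refine mem_upperPair_lattice.2 ⟨a, m * b, ?_⟩
    rw [coe_scaleMatrix_smul]
    push_cast
    ring
  · exact mem_upperPair_lattice.2 ⟨0, 1, by field_simp; simp⟩
  · intro x hx
    obtain ⟨a, b, h⟩ := mem_upperPair_lattice.1 hx
    refine ⟨b, mem_upperPair_lattice.2 ⟨a, 0, ?_⟩⟩
    rw [coe_scaleMatrix_smul] at h
    field_simp
    linear_combination h
  · intro k
    rw [mem_upperPair_lattice]
    constructor
    · rintro ⟨a, b, h⟩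
      refine ⟨b, (eq_of_mul_add_eq τ (a := 0) (a' := m * a) ?_).2⟩
      field_simp at h
      push_cast
      linear_combination h
    · rintro ⟨c, rfl⟩
      exact ⟨0, c, by push_cast; field_simp; simp⟩

/-- The pairs of `j`-invariants related by a cyclic isogeny of degree `m` are the pairs
`(j(τ), j(mτ))`. -/
theorem exists_cyclicIsogeny_iff {m : ℕ} [NeZero m] (hm : 1 < m) {x y : ℂ} :
    (∃ L L' : PeriodPair, jInv L = x ∧ jInv L' = y ∧ CyclicIsogeny m L L') ↔
      ∃ τ : ℍ, kleinJ τ = x ∧ kleinJ (scaleMatrix m • τ) = y := by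
  constructor
  · rintro ⟨L, L', rfl, rfl, h⟩
    obtain ⟨α, w₁, w₂, hα, hw₁, him, hL, hL'⟩ := h.exists_basis hm
    have hm0 : (m : ℂ) ≠ 0 := NeZero.ne _
    have hcoe : w₂ / (m * w₁) = ((m : ℝ)⁻¹ : ℝ) * (w₂ / w₁) := by
      push_cast
      field_simp
    let τ : ℍ := ⟨w₂ / (m * w₁), by
      rw [hcoe, Complex.im_ofReal_mul]
      have : 0 < (m : ℝ) := by positivity
      positivity⟩
    have hτ : (τ : ℂ) = w₂ / (m * w₁) := rfl
    refine ⟨τ, (jInv_eq_kleinJ (α := m * w₁) (mul_ne_zero hm0 hw₁) fun z => ?_).symm,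
      (jInv_eq_kleinJ (α := α * w₁) (mul_ne_zero hα hw₁) fun z => ?_).symm⟩
    · rw [hL, hτ]
      refine exists_congr fun a => exists_congr fun b => ?_
      field_simp
    · rw [hL', coe_scaleMatrix_smul, hτ]
      refine exists_congr fun a => exists_congr fun b => ?_
      field_simp
  · rintro ⟨τ, rfl, rfl⟩
    exact ⟨_, _, jInv_upperPair τ, jInv_upperPair _, cyclicIsogeny_upperPair m τ⟩

/-- `T_m Z` is the image under `j(mτ)` of the preimage of `Z` under `j`, in a power of the modular
curve of level `m`. -/
theorem heckeImage_eq {σ : Type} {m : ℕ} [NeZero m] (hm : 1 < m) (Z : Set (σ → ℂ)) :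
    heckeImage m Z = {w | ∃ x : σ → ModularCurve m, (fun k => levelJ m (x k)) ∈ Z ∧
      w = fun k => levelScaleJ m (x k)} := by
  ext w
  constructor
  · rintro ⟨x, hx, h⟩
    choose τ h1 h2 using fun i => (exists_cyclicIsogeny_iff hm).1 (h i)
    refine ⟨fun i => .mk m (τ i), ?_, funext fun i => (h2 i).symm⟩
    rwa [show (fun i => levelJ m (.mk m (τ i))) = x from funext h1]
  · rintro ⟨x, hx, rfl⟩
    choose τ hτ using fun i => ModularCurve.mk_surjective m (x i)
    exact ⟨_, hx, fun i => (exists_cyclicIsogeny_iff hm).2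
      ⟨τ i, by simp only [← hτ]; rfl, by simp only [← hτ]; rfl⟩⟩

end

end HeckeIrr

end

theorem proposition4p2 (n : ℕ) (hn : 3 ≤ n) (Z : Set (Fin n → ℂ))
    (hZ : HeckeIrr.IsHypersurface Z) (hirr : HeckeIrr.IsZariskiIrreducible Z)
    (hdom : ∀ i : Fin n, HeckeIrr.IsZariskiDense (HeckeIrr.proj i '' Z))
    (m : ℕ) (hm : 1 < m)
    (hl : ∀ l : ℕ, l.Prime → l ∣ m →
      3 < l ∧ ∀ i : Fin n, HeckeIrr.projDegree Z hirr i < l) :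
    HeckeIrr.IsZariskiIrreducible (HeckeIrr.heckeImage m Z) := by
  have : NeZero m := ⟨by omega⟩
  let φ := QuotientGroup.mk' (CongruenceSubgroup.Gamma m)
  have hφ : Function.Surjective φ := QuotientGroup.mk'_surjective _
  have hT : φ ModularGroup.T ^ m = 1 := by
    rw [← map_pow]
    exact (QuotientGroup.eq_one_iff _).2 (by
      simpa using CongruenceSubgroup.ModularGroup_T_pow_mem_Gamma m m dvd_rfl)
  have hm12 : Nat.Coprime m 12 := by
    refine Nat.Coprime.symm (Nat.coprime_of_dvd fun l hl' hl12 hlm => ?_)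
    have h3 := (hl l hl' hlm).1
    have hl3 : l ∣ 2 ^ 2 * 3 := hl12
    rcases (Nat.Prime.dvd_mul hl').1 hl3 with h | h
    · exact absurd (Nat.le_of_dvd (by norm_num) (hl'.dvd_of_dvd_pow h)) (by omega)
    · exact absurd (Nat.le_of_dvd (by norm_num) h) (by omega)
  rw [HeckeIrr.heckeImage_eq hm]
  exact (HeckeIrr.isInvariantDomain_modularAlg m).isZariskiIrreducible_of_isHypersurface
    (by simpa using hn) hZ hirr hdom (HeckeIrr.commutator_eq_top φ hφ hT hm12)
    (HeckeIrr.closure_torsion_eq_top φ hφ hT) (fun l h1 h2 => (hl l h1 h2).2)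
    (HeckeIrr.levelScaleJ_mem m)
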